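/- A \emph{tribe} is a category $\mathcal C$ with a subcategory of \emph{fibrations} containing all objects, where a morphism is called \emph{anodyne} if it has the left lifting property with respect to every fibration, such that: $\mathcal C$ has a terminal object $1$ and every $X\to 1$ is a fibration; pullbacks along fibrations exist and fibrations are stable under pullback; every morphism factors as an anodyne morphism followed by a fibration; anodyne morphisms are stable under pullback along fibrations. A \emph{path object} of $A$ is a factorisation $A\to P_A\to A\times A$ of the diagonal as an anodyne morphism followed by a fibration $(\partial_0,\partial_1)$; morphisms $u,v\colon X\to A$ are \emph{homotopic} if $(u,v)$ factors through $(\partial_0,\partial_1)$ for some path object of $A$; a \emph{homotopy equivalence} is a morphism with an inverse up to homotopy. A commutative square $A\to B\to D$, $A\to C\to D$ is a \emph{homotopy pullback} if, for some (equivalently, any) factorisation of $C\to D$ as an anodyne morphism $C\to C'$ followed by a fibration $C'\to D$, the induced map $A\to B\times_D C'$ is a homotopy equivalence. A morphism $f\colon Y\to B$ is a \emph{homotopy monomorphism} if the square with $\mathrm{id}_Y,\mathrm{id}_Y$ as projections and $f,f$ as legs is a homotopy pullback. For an object $X$, the full subcategory $\mathcal C/\!\!/X\subseteq\mathcal C/X$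 spanned by the fibrations is a tribe, whose fibrations are the morphisms that are fibrations in $\mathcal C$. A \emph{$\pi$-tribe} is a tribe in which, for every fibration $p\colon X\to Y$, the pullback functor $p^*\colon\mathcal C/Y\to\mathcal C/X$ has a partial right adjoint $\Pi_p$ that is defined on all fibrations over $X$, takes values in fibrations over $Y$, and as a functor $\mathcal C/\!\!/X\to\mathcal C/\!\!/Y$ preserves homotopy equivalences. For fibrations $A,B$ over $S$ in a $\pi$-tribe let $\underline{\mathrm{Hom}}_S(A,B)\to S$ be their internal hom, a fibration which represents $T\mapsto \mathrm{Hom}_{\mathcal C/S}(T\times_S A,B)$ on all of $\mathcal C/S$. Given path objects $P_A,P_B$ of $A,B$ in $\mathcal C/\!\!/S$, let $\mathrm{RInv}$ be the pullback of $(\partial_{0*},\partial_{1*})\colon\underline{\mathrm{Hom}}_S(B,P_B)\to\underline{\mathrm{Hom}}_S(B,B)\times_S\underline{\mathrm{Hom}}_S(B,B)$ along the map from $\underline{\mathrm{Hom}}_S(A,B)\times_S\underline{\mathrm{Hom}}_S(B,A)$ whose components are internal composition and the constant map at $\mathrm{id}_B$; define $\mathrm{LInv}$ dually, with $\underline{\mathrm{Hom}}_S(A,P_A)$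 and the constant map at $\mathrm{id}_A$; the \emph{object of equivalences} is $\underline{\mathrm{Eq}}_S(A,B)=\mathrm{RInv}\times_{\underline{\mathrm{Hom}}_S(A,B)}\mathrm{LInv}$. For a fibration $p\colon E\to B$ put $\underline{\mathrm{Eq}}_B(E)=\underline{\mathrm{Eq}}_{B\times B}(\pi_1^*p,\pi_2^*p)$, where $\pi_1,\pi_2\colon B\times B\to B$ are the projections. The identity of $p$, with itself as both inverses and with constant homotopies, gives a morphism $\delta_E\colon B\to\underline{\mathrm{Eq}}_B(E)$ over the diagonal $B\to B\times B$, and $p$ is \emph{univalent} if $\delta_E$ is a homotopy equivalence in $\mathcal C$ (this does not depend on the choice of path objects). \textbf{Proposition.} Let $\mathcal C$ be a $\pi$-tribe, let $p\colon E\to B$ be a univalent fibration and $f\colon Y\to B$ a fibration, and let $$\begin{array}{ccc} X & \xrightarrow{\;h\;} & E\\ {\scriptstyle q}\downarrow & & \downarrow{\scriptstyle p}\\ Y & \xrightarrow{\;f\;} & B\end{array}$$ be a pullback square. Then $q$ is univalent if and only if $f$ is a homotopy monomorphism. -/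

import Mathlib

open CategoryTheory CategoryTheory.Limits

universe v u

/-- A tribe: a category with a (wide) subcategory of fibrations. The class `fib.llp` of morphisms
with the left lifting property against all fibrations is the class of anodyne morphisms. -/
class Tribe (C : Type u) [Category.{v} C] where
  fib : MorphismProperty C
  isMultiplicative : fib.IsMultiplicative
  hasTerminal : HasTerminal C
  fib_from : ∀ X : C, fib (terminal.from X)
  hasPullback : ∀ {X Y Z : C} (f : X ⟶ Z) (g : Y ⟶ Z), fib g → HasPullback f g
  isStableUnderBaseChange : fib.IsStableUnderBaseChange
  hasFactorization : fib.llp.HasFactorization fib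
  anodyne_of_isPullback : ∀ {P X Y Z : C} {i' : P ⟶ Y} {q' : P ⟶ X} {q : Y ⟶ Z} {i : X ⟶ Z},
    IsPullback i' q' q i → fib q → fib.llp i → fib.llp i'

namespace Tribe

attribute [instance] isMultiplicative hasTerminal isStableUnderBaseChange hasFactorization

section Slice

variable {C : Type u} [Category.{v} C] [Tribe C]

/-- The fibrant slice over `X`: the full subcategory of `Over X` spanned by the fibrations. -/
abbrev FibrantSlice (X : C) : Type (max u v) :=
  ((fib (C := C)).overObj (X := X)).FullSubcategory

/-- The object of the fibrant slice given by a fibration. -/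
abbrev FibrantSlice.mk {X A : C} (p : A ⟶ X) (hp : fib p) : FibrantSlice X :=
  ⟨Over.mk p, hp⟩

instance hasPullback_right {X Y : C} (f : Y ⟶ X) (A : FibrantSlice X) :
    HasPullback f A.obj.hom :=
  hasPullback f A.obj.hom A.property

lemma fib_pullback_fst {X Y Z : C} (f : X ⟶ Z) (g : Y ⟶ Z) (hg : fib g) [HasPullback f g] :
    fib (pullback.fst f g) :=
  MorphismProperty.of_isPullback (IsPullback.of_hasPullback f g).flip hg

lemma fib_pullback_snd {X Y Z : C} (f : X ⟶ Z) (g : Y ⟶ Z) (hf : fib f) [HasPullback f g] :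
    fib (pullback.snd f g) :=
  MorphismProperty.of_isPullback (IsPullback.of_hasPullback f g) hf

/-- The fibrations of the fibrant slice: the morphisms whose underlying morphism is one. -/
def sliceFib (X : C) : MorphismProperty (FibrantSlice X) :=
  fun _ _ f ↦ fib f.hom.left

/-- A pullback in the fibrant slice of a fibration, built from the pullback in `C`. -/
lemma slice_exists_isPullback {X : C} {A B D : FibrantSlice X} (f : A ⟶ D) (g : B ⟶ D)
    (hg : sliceFib X g) :
    ∃ (P : FibrantSlice X) (a : P ⟶ A) (b : P ⟶ B), IsPullback a b f g ∧
      IsPullback a.hom.left b.hom.left f.hom.left g.hom.left := by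
  have : HasPullback f.hom.left g.hom.left := hasPullback _ _ hg
  let P : FibrantSlice X := FibrantSlice.mk (pullback.fst f.hom.left g.hom.left ≫ A.obj.hom)
    (MorphismProperty.comp_mem _ _ _ (fib_pullback_fst _ _ hg) A.property)
  let a : P ⟶ A := ObjectProperty.homMk (Over.homMk (pullback.fst f.hom.left g.hom.left) rfl)
  let b : P ⟶ B := ObjectProperty.homMk (Over.homMk (pullback.snd f.hom.left g.hom.left) (by
    have h1 := Over.w f.hom
    have h2 := Over.w g.hom
    dsimp [P]
    rw [← h1, ← h2, pullback.condition_assoc]))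
  have hab : a ≫ f = b ≫ g := by
    ext
    exact pullback.condition
  refine ⟨P, a, b, ⟨⟨hab⟩, ⟨PullbackCone.IsLimit.mk hab
    (fun s ↦ ObjectProperty.homMk (Over.homMk (pullback.lift s.fst.hom.left s.snd.hom.left
      (congrArg (fun k ↦ k.hom.left) s.condition)) ?_)) ?_ ?_ ?_⟩⟩,
    IsPullback.of_hasPullback _ _⟩
  · exact (pullback.lift_fst_assoc _ _ _ _).trans (Over.w s.fst.hom)
  · intro s
    ext
    exact pullback.lift_fst _ _ _
  · intro s
    ext
    exact pullback.lift_snd _ _ _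
  · intro s m h1 h2
    ext
    apply pullback.hom_ext
    · exact (congrArg (fun k ↦ k.hom.left) h1).trans
        (pullback.lift_fst (f := f.hom.left) (g := g.hom.left) _ _ _).symm
    · exact (congrArg (fun k ↦ k.hom.left) h2).trans
        (pullback.lift_snd (f := f.hom.left) (g := g.hom.left) _ _ _).symm

lemma slice_isPullback_left {X : C} {P A B D : FibrantSlice X} {a : P ⟶ A} {b : P ⟶ B}
    {f : A ⟶ D} {g : B ⟶ D} (sq : IsPullback a b f g) (hg : sliceFib X g) :
    IsPullback a.hom.left b.hom.left f.hom.left g.hom.left := by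
  obtain ⟨P', a', b', sq', sq''⟩ := slice_exists_isPullback f g hg
  let e := sq.isoIsPullback _ _ sq'
  let F : FibrantSlice X ⥤ C := ObjectProperty.ι _ ⋙ Over.forget X
  exact IsPullback.of_iso sq'' (F.mapIso e).symm (Iso.refl _) (Iso.refl _) (Iso.refl _)
    ((Category.comp_id _).trans (congrArg F.map (sq.isoIsPullback_inv_fst _ _ sq').symm))
    ((Category.comp_id _).trans (congrArg F.map (sq.isoIsPullback_inv_snd _ _ sq').symm))
    (by simp) (by simp)

lemma slice_llp_iff {X : C} {A B : FibrantSlice X} (f : A ⟶ B) :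
    (sliceFib X).llp f ↔ (fib (C := C)).llp f.hom.left := by
  constructor
  · intro h E F p hp
    refine ⟨fun {s t} sq ↦ ?_⟩
    have := hasPullback t p hp
    let Q : FibrantSlice X := FibrantSlice.mk (pullback.fst t p ≫ B.obj.hom)
      (MorphismProperty.comp_mem _ _ _ (fib_pullback_fst _ _ hp) B.property)
    let q : Q ⟶ B := ObjectProperty.homMk (Over.homMk (pullback.fst t p) rfl)
    have hq : sliceFib X q := fib_pullback_fst _ _ hp
    let a : A ⟶ Q := ObjectProperty.homMk (Over.homMk
      (pullback.lift f.hom.left s sq.w.symm) ((pullback.lift_fst_assoc _ _ _ _).trans (Over.w f.hom)))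
    have w : a ≫ q = f ≫ 𝟙 B := by
      ext
      exact (pullback.lift_fst _ _ _).trans (Category.comp_id _).symm
    have := h q hq
    have csq : CommSq a f q (𝟙 B) := ⟨w⟩
    have e1 : f.hom.left ≫ csq.lift.hom.left = a.hom.left :=
      congrArg (fun k ↦ k.hom.left) csq.fac_left
    have e2 : csq.lift.hom.left ≫ q.hom.left = 𝟙 _ :=
      congrArg (fun k ↦ k.hom.left) csq.fac_right
    refine ⟨⟨⟨csq.lift.hom.left ≫ pullback.snd t p, ?_, ?_⟩⟩⟩
    · rw [reassoc_of% e1]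
      exact pullback.lift_snd _ _ _
    · have e3 : csq.lift.hom.left ≫ pullback.fst t p = 𝟙 _ := e2
      rw [Category.assoc, ← pullback.condition, reassoc_of% e3]
  · intro h E F p hp
    refine ⟨fun {s t} sq ↦ ?_⟩
    have := h p.hom.left hp
    have csq : CommSq s.hom.left f.hom.left p.hom.left t.hom.left :=
      ⟨congrArg (fun k ↦ k.hom.left) sq.w⟩
    refine ⟨⟨⟨ObjectProperty.homMk (Over.homMk csq.lift ?_), ?_, ?_⟩⟩⟩
    · rw [← Over.w p.hom, csq.fac_right_assoc, Over.w t.hom]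
    · ext
      exact csq.fac_left
    · ext
      exact csq.fac_right

/-- The fibrant slice of a tribe is a tribe. -/
noncomputable instance slice (X : C) : Tribe (FibrantSlice X) :=
  have term : IsTerminal (FibrantSlice.mk (𝟙 X) (MorphismProperty.id_mem _ X)) :=
    IsTerminal.ofUniqueHom (fun A ↦ ObjectProperty.homMk (Over.homMk A.obj.hom))
      (fun A m ↦ by
        ext
        simpa using Over.w m.hom)
  have : HasTerminal (FibrantSlice X) := term.hasTerminal
  { fib := sliceFib X
    isMultiplicative :=
      { id_mem := fun A ↦ (fib (C := C)).id_mem A.obj.left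
        comp_mem := fun f g hf hg ↦ (fib (C := C)).comp_mem f.hom.left g.hom.left hf hg }
    hasTerminal := this
    fib_from := fun A ↦ by
      let T : FibrantSlice X := ⊤_ (FibrantSlice X)
      let e : T ≅ FibrantSlice.mk (𝟙 X) (MorphismProperty.id_mem _ X) :=
        terminalIsTerminal.uniqueUpToIso term
      have h : IsIso T.obj.hom := by
        have hw : e.hom.hom.left = T.obj.hom := by simpa using Over.w e.hom.hom
        rw [← hw]
        exact ((ObjectProperty.ι _ ⋙ Over.forget X).mapIso e).isIso_hom
      have hw : (terminal.from A).hom.left ≫ T.obj.hom = A.obj.hom := Over.w _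
      have := A.property
      rw [MorphismProperty.overObj_iff, ← hw] at this
      exact (MorphismProperty.cancel_right_of_respectsIso (fib (C := C)) _ T.obj.hom).1 this
    hasPullback := fun f g hg ↦ by
      obtain ⟨P, a, b, sq, -⟩ := slice_exists_isPullback f g hg
      exact sq.hasPullback
    isStableUnderBaseChange :=
      { of_isPullback := fun {A B B' D f g f' g'} sq hg ↦
          MorphismProperty.of_isPullback (P := fib (C := C)) (slice_isPullback_left sq.flip hg).flip
            hg }
    hasFactorization :=
      { nonempty_mapFactorizationData := fun {A B} f ↦ by
          obtain ⟨d⟩ := MorphismProperty.HasFactorization.nonempty_mapFactorizationData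
            (W₁ := (fib (C := C)).llp) (W₂ := fib (C := C)) f.hom.left
          let Z : FibrantSlice X := FibrantSlice.mk (d.p ≫ B.obj.hom)
            (MorphismProperty.comp_mem _ _ _ d.hp B.property)
          exact ⟨{
            Z := Z
            i := ObjectProperty.homMk (Over.homMk d.i (by simp [Z]))
            p := ObjectProperty.homMk (Over.homMk d.p rfl)
            fac := by
              ext
              exact d.fac
            hi := (slice_llp_iff _).2 d.hi
            hp := d.hp }⟩ }
    anodyne_of_isPullback := fun sq hq hi ↦ (slice_llp_iff _).2
      (anodyne_of_isPullback (slice_isPullback_left sq.flip hq).flip hq ((slice_llp_iff _).1 hi)) }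

end Slice

section Homotopy

variable {C : Type u} [Category.{v} C] [Tribe C]

instance hasBinaryProduct (A B : C) : HasBinaryProduct A B :=
  have : HasPullback (terminal.from A) (terminal.from B) := hasPullback _ _ (fib_from B)
  let a : pullback (terminal.from A) (terminal.from B) ⟶ A := pullback.fst _ _
  let b : pullback (terminal.from A) (terminal.from B) ⟶ B := pullback.snd _ _
  ⟨⟨_, BinaryFan.IsLimit.mk (BinaryFan.mk a b)
    (fun f g ↦ pullback.lift f g (Subsingleton.elim _ _))
    (fun f g ↦ pullback.lift_fst f g _) (fun f g ↦ pullback.lift_snd f g _)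
    (fun f g _ h1 h2 ↦ pullback.hom_ext (h1.trans (pullback.lift_fst f g _).symm)
      (h2.trans (pullback.lift_snd f g _).symm))⟩⟩

/-- A path object of `A`: a factorisation of the diagonal of `A` as an anodyne morphism `refl`
followed by a fibration `(fst, snd)`. -/
structure PathObject (A : C) where
  obj : C
  refl : A ⟶ obj
  fst : obj ⟶ A
  snd : obj ⟶ A
  refl_fst : refl ≫ fst = 𝟙 A
  refl_snd : refl ≫ snd = 𝟙 A
  anodyne_refl : (fib (C := C)).llp refl
  fib_lift : fib (prod.lift fst snd)

/-- Every object of a tribe has a path object. -/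
lemma nonempty_pathObject (A : C) : Nonempty (PathObject A) := by
  obtain ⟨d⟩ := MorphismProperty.HasFactorization.nonempty_mapFactorizationData
    (W₁ := (fib (C := C)).llp) (W₂ := fib (C := C)) (diag A)
  exact ⟨{
    obj := d.Z
    refl := d.i
    fst := d.p ≫ prod.fst
    snd := d.p ≫ prod.snd
    refl_fst := by rw [d.fac_assoc, prod.lift_fst]
    refl_snd := by rw [d.fac_assoc, prod.lift_snd]
    anodyne_refl := d.hi
    fib_lift := by
      have h : prod.lift (d.p ≫ prod.fst) (d.p ≫ prod.snd) = d.p := by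
        apply Limits.prod.hom_ext
        · rw [prod.lift_fst]
        · rw [prod.lift_snd]
      rw [h]
      exact d.hp }⟩

/-- Two morphisms are homotopic if there is a homotopy between them, for some path object of the
codomain. -/
def Homotopic {A B : C} (f g : A ⟶ B) : Prop :=
  ∃ (P : PathObject B) (h : A ⟶ P.obj), h ≫ P.fst = f ∧ h ≫ P.snd = g

/-- A homotopy equivalence: a morphism with an inverse up to homotopy. -/
def IsHomotopyEquiv {A B : C} (f : A ⟶ B) : Prop :=
  ∃ g : B ⟶ A, Homotopic (f ≫ g) (𝟙 A) ∧ Homotopic (g ≫ f) (𝟙 B)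

/-- The commutative square with top `t`, left side `l`, right side `r` and bottom `b` is a homotopy
pullback: for a factorisation of `b` as an anodyne morphism followed by a fibration
`Z ⟶ Y`, the comparison map from `A` to the pullback of `Z` along `r` is a homotopy equivalence.
(This does not depend on the factorisation.) -/
def IsHomotopyPullback {A B X Y : C} (t : A ⟶ B) (l : A ⟶ X) (r : B ⟶ Y) (b : X ⟶ Y) : Prop :=
  ∃ (w : t ≫ r = l ≫ b) (d : MorphismProperty.MapFactorizationData (fib (C := C)).llp fib b),
    haveI := hasPullback r d.p d.hp
    IsHomotopyEquiv (pullback.lift (f := r) (g := d.p) t (l ≫ d.i) (by simp [w]))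

/-- A morphism `f : Y ⟶ B` is a homotopy monomorphism if the square with both legs `f` and both
projections `𝟙 Y` is a homotopy pullback. -/
def IsHomotopyMono {Y B : C} (f : Y ⟶ B) : Prop :=
  IsHomotopyPullback (𝟙 Y) (𝟙 Y) f f

end Homotopy

section Pi

variable {C : Type u} [Category.{v} C] [Tribe C]

/-- Pullback along a fibration `p : X ⟶ Y`, on the full slices. -/
noncomputable abbrev pullbackFunctor {X Y : C} (p : X ⟶ Y) (hp : fib p) : Over Y ⥤ Over X :=
  haveI : HasPullbacksAlong p := fun h ↦ hasPullback h p hp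
  Over.pullback p

variable (C) in
/-- For every fibration `p`, the partial right adjoint of pullback along `p` is defined on all
fibrations, with values in fibrations. -/
class HasDependentProducts : Prop where
  isDefined : ∀ {X Y : C} (p : X ⟶ Y) (hp : fib p) (A : FibrantSlice X),
    (pullbackFunctor p hp).rightAdjointObjIsDefined A.obj
  fib_hom : ∀ {X Y : C} (p : X ⟶ Y) (hp : fib p) (A : FibrantSlice X),
    fib ((pullbackFunctor p hp).partialRightAdjointObj ⟨A.obj, isDefined p hp A⟩).hom

section

variable [HasDependentProducts C]

/-- The dependent product of a fibration `A` over `X` along a fibration `p : X ⟶ Y`. -/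
noncomputable def piObj {X Y : C} (p : X ⟶ Y) (hp : fib p) (A : FibrantSlice X) :
    FibrantSlice Y :=
  ⟨(pullbackFunctor p hp).partialRightAdjointObj
    ⟨A.obj, HasDependentProducts.isDefined p hp A⟩, HasDependentProducts.fib_hom p hp A⟩

/-- The action of the dependent product along `p` on a morphism between fibrations over `X`. -/
noncomputable def piMap {X Y : C} (p : X ⟶ Y) (hp : fib p) {A A' : FibrantSlice X} (u : A ⟶ A') :
    piObj p hp A ⟶ piObj p hp A' :=
  ObjectProperty.homMk ((pullbackFunctor p hp).partialRightAdjointMap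
    (X := ⟨A.obj, HasDependentProducts.isDefined p hp A⟩)
    (Y := ⟨A'.obj, HasDependentProducts.isDefined p hp A'⟩) (ObjectProperty.homMk u.hom))

/-- The defining bijection of the dependent product; `W` is an arbitrary object over `Y`. -/
noncomputable def piEquiv {X Y : C} (p : X ⟶ Y) (hp : fib p) (A : FibrantSlice X) (W : Over Y) :
    (W ⟶ (piObj p hp A).obj) ≃ ((pullbackFunctor p hp).obj W ⟶ A.obj) :=
  (pullbackFunctor p hp).partialRightAdjointHomEquiv
    (Y := ⟨A.obj, HasDependentProducts.isDefined p hp A⟩)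

lemma piEquiv_comp {X Y : C} (p : X ⟶ Y) (hp : fib p) (A : FibrantSlice X) {W W' : Over Y}
    (g : W ⟶ W') (f : W' ⟶ (piObj p hp A).obj) :
    piEquiv p hp A W (g ≫ f) = (pullbackFunctor p hp).map g ≫ piEquiv p hp A W' f :=
  Functor.partialRightAdjointHomEquiv_comp ..

end

variable (C) in
/-- A `π`-tribe: a tribe in which pullback along every fibration `p : X ⟶ Y` has a partial right
adjoint, defined as a functor between the fibrant slices and preserving homotopy equivalences. -/
class IsPiTribe : Prop extends HasDependentProducts C where
  isHomotopyEquiv_piMap : ∀ {X Y : C} (p : X ⟶ Y) (hp : fib p) {A A' : FibrantSlice X}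
    (u : A ⟶ A'), IsHomotopyEquiv u → IsHomotopyEquiv (piMap p hp u)

end Pi

section Product

variable {C : Type u} [Category.{v} C] [Tribe C] {S : C}

/-- The product in `Over S` of an arbitrary object `X` and a fibration `A`. -/
noncomputable abbrev tensor (X : Over S) (A : FibrantSlice S) : Over S :=
  (Over.map A.obj.hom).obj ((pullbackFunctor A.obj.hom A.property).obj X)

/-- The product of a morphism over `S` with the identity of `A`. -/
noncomputable abbrev tmap {X X' : Over S} (u : X ⟶ X') (A : FibrantSlice S) :
    tensor X A ⟶ tensor X' A :=
  (Over.map A.obj.hom).map ((pullbackFunctor A.obj.hom A.property).map u)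

noncomputable def tfst (X : Over S) (A : FibrantSlice S) : tensor X A ⟶ X :=
  Over.homMk (pullback.fst X.hom A.obj.hom) pullback.condition

noncomputable def tsnd (X : Over S) (A : FibrantSlice S) : tensor X A ⟶ A.obj :=
  Over.homMk (pullback.snd X.hom A.obj.hom) rfl

noncomputable def tlift {W X : Over S} {A : FibrantSlice S} (a : W ⟶ X) (b : W ⟶ A.obj) :
    W ⟶ tensor X A :=
  Over.homMk (pullback.lift a.left b.left ((Over.w a).trans (Over.w b).symm))
    ((pullback.lift_snd_assoc (f := X.hom) (g := A.obj.hom) _ _ _ _).trans (Over.w b))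

@[simp]
lemma tlift_tfst {W X : Over S} {A : FibrantSlice S} (a : W ⟶ X) (b : W ⟶ A.obj) :
    tlift a b ≫ tfst X A = a := by
  ext
  exact pullback.lift_fst (f := X.hom) (g := A.obj.hom) _ _ _

@[simp]
lemma tlift_tsnd {W X : Over S} {A : FibrantSlice S} (a : W ⟶ X) (b : W ⟶ A.obj) :
    tlift a b ≫ tsnd X A = b := by
  ext
  exact pullback.lift_snd (f := X.hom) (g := A.obj.hom) _ _ _

lemma tensor_hom_ext {W X : Over S} {A : FibrantSlice S} {a b : W ⟶ tensor X A}
    (h1 : a ≫ tfst X A = b ≫ tfst X A) (h2 : a ≫ tsnd X A = b ≫ tsnd X A) : a = b := by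
  ext
  exact pullback.hom_ext (congrArg (fun k ↦ k.left) h1) (congrArg (fun k ↦ k.left) h2)

@[simp]
lemma tmap_tfst {X X' : Over S} (u : X ⟶ X') (A : FibrantSlice S) :
    tmap u A ≫ tfst X' A = tfst X A ≫ u := by
  ext
  exact pullback.lift_fst (f := X'.hom) (g := A.obj.hom) _ _ _

@[simp]
lemma tmap_tsnd {X X' : Over S} (u : X ⟶ X') (A : FibrantSlice S) :
    tmap u A ≫ tsnd X' A = tsnd X A := by
  ext
  exact pullback.lift_snd (f := X'.hom) (g := A.obj.hom) _ _ _

lemma comp_tlift {V W X : Over S} {A : FibrantSlice S} (v : V ⟶ W) (a : W ⟶ X)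
    (b : W ⟶ A.obj) : v ≫ tlift a b = tlift (v ≫ a) (v ≫ b) :=
  tensor_hom_ext (by simp) (by simp)

lemma fib_tfst_left (X : Over S) (A : FibrantSlice S) : fib (tfst X A).left :=
  fib_pullback_fst X.hom A.obj.hom A.property

lemma fib_tsnd_left (H A : FibrantSlice S) : fib (tsnd H.obj A).left :=
  fib_pullback_snd H.obj.hom A.obj.hom H.property

/-- The product of two fibrations over `S` in the fibrant slice. -/
noncomputable abbrev prodObj (H A : FibrantSlice S) : FibrantSlice S :=
  ⟨tensor H.obj A, MorphismProperty.comp_mem fib _ _ (fib_tsnd_left H A) A.property⟩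

lemma fib_pathObject_tlift {B : FibrantSlice S} (P : PathObject B) :
    fib (tlift (X := B.obj) (A := B) P.fst.hom P.snd.hom).left := by
  let c : prodObj B B ⟶ B ⨯ B :=
    prod.lift (ObjectProperty.homMk (tfst B.obj B)) (ObjectProperty.homMk (tsnd B.obj B))
  let c' : B ⨯ B ⟶ prodObj B B := ObjectProperty.homMk
    (tlift (X := B.obj) (A := B) (prod.fst (X := B) (Y := B)).hom (prod.snd (X := B) (Y := B)).hom)
  let p : P.obj ⟶ prodObj B B := ObjectProperty.homMk
    (tlift (X := B.obj) (A := B) P.fst.hom P.snd.hom)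
  have hfst (W : FibrantSlice S) (m : W ⟶ prodObj B B) :
      m ≫ c ≫ prod.fst = ObjectProperty.homMk (m.hom ≫ tfst B.obj B) := by
    simp only [c, prod.lift_fst]
    rfl
  have hsnd (W : FibrantSlice S) (m : W ⟶ prodObj B B) :
      m ≫ c ≫ prod.snd = ObjectProperty.homMk (m.hom ≫ tsnd B.obj B) := by
    simp only [c, prod.lift_snd]
    rfl
  have hcc' : c ≫ c' = 𝟙 _ := by
    ext1
    refine tensor_hom_ext ?_ ?_
    · have := congrArg (fun k ↦ k.hom) (hfst _ (𝟙 _))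
      simp only [Category.id_comp] at this
      exact (Category.assoc _ _ _).trans ((congrArg (c.hom ≫ ·) (tlift_tfst _ _)).trans this)
    · have := congrArg (fun k ↦ k.hom) (hsnd _ (𝟙 _))
      simp only [Category.id_comp] at this
      exact (Category.assoc _ _ _).trans ((congrArg (c.hom ≫ ·) (tlift_tsnd _ _)).trans this)
  have hc'c : c' ≫ c = 𝟙 _ := by
    apply Limits.prod.hom_ext
    · rw [Category.assoc, hfst, Category.id_comp]
      ext1
      exact tlift_tfst _ _
    · rw [Category.assoc, hsnd, Category.id_comp]
      ext1
      exact tlift_tsnd _ _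
  let e : B ⨯ B ≅ prodObj B B := ⟨c', c, hc'c, hcc'⟩
  have hp : p = prod.lift P.fst P.snd ≫ e.hom := by
    rw [← Iso.comp_inv_eq]
    apply Limits.prod.hom_ext
    · refine (Category.assoc p c prod.fst).trans ((hfst _ p).trans ?_)
      rw [prod.lift_fst]
      ext1
      exact tlift_tfst _ _
    · refine (Category.assoc p c prod.snd).trans ((hsnd _ p).trans ?_)
      rw [prod.lift_snd]
      ext1
      exact tlift_tsnd _ _
  have h : (fib (C := FibrantSlice S)) p := by
    rw [hp]
    have : IsIso e.hom := e.isIso_hom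
    exact MorphismProperty.comp_mem _ _ _ P.fib_lift
      (MorphismProperty.of_isPullback (IsPullback.of_horiz_isIso
        (⟨by simp⟩ : CommSq e.hom e.hom (𝟙 _) (𝟙 _))) (MorphismProperty.id_mem _ _))
  exact h

/-- The pullback in `Over S` of a morphism `d` between fibrations whose underlying morphism is a
fibration, along any morphism `u` between fibrations. -/
noncomputable def pbObj {Z K W : FibrantSlice S} (u : Z.obj ⟶ W.obj) (d : K.obj ⟶ W.obj)
    (hd : fib d.left) : FibrantSlice S :=
  haveI := hasPullback u.left d.left hd
  FibrantSlice.mk (pullback.fst u.left d.left ≫ Z.obj.hom)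
    (MorphismProperty.comp_mem fib _ _ (fib_pullback_fst _ _ hd) Z.property)

section

variable {Z K W : FibrantSlice S} (u : Z.obj ⟶ W.obj) (d : K.obj ⟶ W.obj) (hd : fib d.left)

noncomputable def pbFst : (pbObj u d hd).obj ⟶ Z.obj :=
  haveI := hasPullback u.left d.left hd
  Over.homMk (pullback.fst u.left d.left) rfl

noncomputable def pbSnd : (pbObj u d hd).obj ⟶ K.obj :=
  haveI := hasPullback u.left d.left hd
  Over.homMk (pullback.snd u.left d.left) (by
    change _ = pullback.fst u.left d.left ≫ Z.obj.hom
    rw [← Over.w u, ← Over.w d, pullback.condition_assoc]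
    rfl)

lemma fib_pbFst_left : fib (pbFst u d hd).left :=
  haveI := hasPullback u.left d.left hd
  fib_pullback_fst u.left d.left hd

variable {u d} in
/-- The universal property of `pbObj`. -/
noncomputable def pbLift {X : Over S} (a : X ⟶ Z.obj) (b : X ⟶ K.obj) (w : a ≫ u = b ≫ d) :
    X ⟶ (pbObj u d hd).obj :=
  haveI := hasPullback u.left d.left hd
  Over.homMk (pullback.lift a.left b.left (congrArg (fun k ↦ k.left) w))
    ((pullback.lift_fst_assoc (f := u.left) (g := d.left) _ _ _ _).trans (Over.w a))

variable {u d} in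
@[simp]
lemma pbLift_pbFst {X : Over S} (a : X ⟶ Z.obj) (b : X ⟶ K.obj) (w : a ≫ u = b ≫ d) :
    pbLift hd a b w ≫ pbFst u d hd = a := by
  have := hasPullback u.left d.left hd
  ext
  exact pullback.lift_fst (f := u.left) (g := d.left) _ _ _

end

end Product

section InternalHom

variable {C : Type u} [Category.{v} C] [Tribe C] [HasDependentProducts C] {S : C}

/-- The internal hom of fibrations over `S`: the dependent product along `A` of the pullback of
`B` along `A`. -/
noncomputable def ihom (A B : FibrantSlice S) : FibrantSlice S :=
  piObj A.obj.hom A.property ⟨(pullbackFunctor A.obj.hom A.property).obj B.obj,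
    fib_pullback_snd B.obj.hom A.obj.hom B.property⟩

/-- Transposition for the internal hom, where `X` is an arbitrary object over `S`. -/
noncomputable def curryEquiv (X : Over S) (A B : FibrantSlice S) :
    (X ⟶ (ihom A B).obj) ≃ (tensor X A ⟶ B.obj) :=
  haveI : HasPullbacksAlong A.obj.hom := fun h ↦ hasPullback h A.obj.hom A.property
  (piEquiv A.obj.hom A.property _ X).trans ((Over.mapPullbackAdj A.obj.hom).homEquiv _ _).symm

noncomputable def curry {X : Over S} {A B : FibrantSlice S} (e : tensor X A ⟶ B.obj) :
    X ⟶ (ihom A B).obj :=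
  (curryEquiv X A B).symm e

noncomputable def uncurry {X : Over S} {A B : FibrantSlice S} (e : X ⟶ (ihom A B).obj) :
    tensor X A ⟶ B.obj :=
  curryEquiv X A B e

@[simp]
lemma uncurry_curry {X : Over S} {A B : FibrantSlice S} (e : tensor X A ⟶ B.obj) :
    uncurry (curry e) = e :=
  (curryEquiv X A B).apply_symm_apply e

@[simp]
lemma curry_uncurry {X : Over S} {A B : FibrantSlice S} (e : X ⟶ (ihom A B).obj) :
    curry (uncurry e) = e :=
  (curryEquiv X A B).symm_apply_apply e

lemma uncurry_comp {X X' : Over S} {A B : FibrantSlice S} (g : X ⟶ X')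
    (f : X' ⟶ (ihom A B).obj) : uncurry (g ≫ f) = tmap g A ≫ uncurry f := by
  have : HasPullbacksAlong A.obj.hom := fun h ↦ hasPullback h A.obj.hom A.property
  exact (congrArg _ (piEquiv_comp A.obj.hom A.property _ g f)).trans
    ((Over.mapPullbackAdj A.obj.hom).homEquiv_naturality_left_symm _ _)

lemma comp_curry {X X' : Over S} {A B : FibrantSlice S} (g : X ⟶ X')
    (e : tensor X' A ⟶ B.obj) : g ≫ curry e = curry (tmap g A ≫ e) := by
  apply (curryEquiv X A B).injective
  change uncurry _ = uncurry _
  rw [uncurry_comp, uncurry_curry, uncurry_curry]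

/-- Postcomposition with `r` on internal homs. -/
noncomputable def postcomp (A : FibrantSlice S) {B D : FibrantSlice S} (r : B.obj ⟶ D.obj) :
    (ihom A B).obj ⟶ (ihom A D).obj :=
  curry (uncurry (𝟙 _) ≫ r)

lemma uncurry_postcomp {X : Over S} {A B D : FibrantSlice S} (f : X ⟶ (ihom A B).obj)
    (r : B.obj ⟶ D.obj) : uncurry (f ≫ postcomp A r) = uncurry f ≫ r := by
  rw [uncurry_comp, postcomp, uncurry_curry, ← Category.assoc, ← uncurry_comp, Category.comp_id]

lemma curry_postcomp {X : Over S} {A B D : FibrantSlice S} (e : tensor X A ⟶ B.obj)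
    (r : B.obj ⟶ D.obj) : curry e ≫ postcomp A r = curry (e ≫ r) := by
  apply (curryEquiv X A D).injective
  change uncurry _ = uncurry _
  rw [uncurry_postcomp, uncurry_curry, uncurry_curry]

/-- Internal composition on generalised elements `g` and `f` of internal homs: the transpose of the
composite of the transposes over `X`. For `g` and `f` the two projections from a product of internal
homs this is the internal composition morphism. -/
noncomputable def icomp {X : Over S} {A B D : FibrantSlice S} (g : X ⟶ (ihom B D).obj)
    (f : X ⟶ (ihom A B).obj) : X ⟶ (ihom A D).obj :=
  curry (tlift (tfst X A) (uncurry f) ≫ uncurry g)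

/-- The constant morphism at the identity of `A`. -/
noncomputable def constId (X : Over S) (A : FibrantSlice S) : X ⟶ (ihom A A).obj :=
  curry (tsnd X A)

lemma comp_constId {X X' : Over S} (u : X ⟶ X') (A : FibrantSlice S) :
    u ≫ constId X' A = constId X A := by
  rw [constId, comp_curry, tmap_tsnd, constId]

lemma comp_icomp {X X' : Over S} {A B D : FibrantSlice S} (u : X ⟶ X')
    (g : X' ⟶ (ihom B D).obj) (f : X' ⟶ (ihom A B).obj) :
    u ≫ icomp g f = icomp (u ≫ g) (u ≫ f) := by
  rw [icomp, comp_curry, icomp, uncurry_comp, uncurry_comp, ← Category.assoc, ← Category.assoc]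
  congr 2
  apply tensor_hom_ext
  · rw [Category.assoc, tlift_tfst, tmap_tfst, Category.assoc, tmap_tfst, ← Category.assoc,
      tlift_tfst]
  · rw [Category.assoc, tlift_tsnd, Category.assoc, tmap_tsnd, tlift_tsnd]

lemma icomp_curry {X : Over S} {A B D : FibrantSlice S} (g : tensor X B ⟶ D.obj)
    (f : tensor X A ⟶ B.obj) : icomp (curry g) (curry f) = curry (tlift (tfst X A) f ≫ g) := by
  rw [icomp, uncurry_curry, uncurry_curry]

/-- If `d : K ⟶ Z` is universal among lifts of the transposed family `z` along a fibration `r`,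
then `d` is a fibration (it is a dependent product of a pullback of `r`). -/
lemma fib_of_universal {A P D Z : FibrantSlice S} {K : Over S} (r : P.obj ⟶ D.obj)
    (hr : fib r.left) (d : K ⟶ Z.obj) (z : tensor Z.obj A ⟶ D.obj) (k : tensor K A ⟶ P.obj)
    (hk : k ≫ r = tmap d A ≫ z)
    (hex : ∀ (X : Over S) (v : X ⟶ Z.obj) (w : tensor X A ⟶ P.obj), w ≫ r = tmap v A ≫ z →
      ∃ m : X ⟶ K, m ≫ d = v ∧ tmap m A ≫ k = w)
    (huniq : ∀ (X : Over S) (m m' : X ⟶ K), m ≫ d = m' ≫ d → tmap m A ≫ k = tmap m' A ≫ k →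
      m = m') : fib d.left := by
  have hπ : fib (tfst Z.obj A).left := fib_tfst_left Z.obj A
  have hzr : HasPullback z.left r.left := hasPullback _ _ hr
  let Q : FibrantSlice (tensor Z.obj A).left :=
    FibrantSlice.mk (pullback.fst z.left r.left) (fib_pullback_fst _ _ hr)
  let F := pullbackFunctor (tfst Z.obj A).left hπ
  have hp (T : Over Z.obj.left) : HasPullback T.hom (tfst Z.obj A).left := hasPullback _ _ hπ
  -- comparison maps between the two ways of forming the product
  let T' (T : Over Z.obj.left) : Over S := Over.mk (T.hom ≫ Z.obj.hom)
  let vT (T : Over Z.obj.left) : T' T ⟶ Z.obj := Over.homMk T.hom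
  let φ (T : Over Z.obj.left) : (F.obj T).left ⟶ (tensor (T' T) A).left :=
    pullback.lift (f := (T' T).hom) (g := A.obj.hom) (pullback.fst T.hom (tfst Z.obj A).left)
      (pullback.snd T.hom (tfst Z.obj A).left ≫ (tsnd Z.obj A).left) (by
        have h1 := Over.w (tfst Z.obj A)
        have h2 := Over.w (tsnd Z.obj A)
        have h3 := pullback.condition (f := T.hom) (g := (tfst Z.obj A).left)
        change _ ≫ T.hom ≫ Z.obj.hom = _
        rw [reassoc_of% h3, h1, Category.assoc]
        exact congrArg _ h2.symm)
  let ψ (T : Over Z.obj.left) : (tensor (T' T) A).left ⟶ (F.obj T).left :=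
    pullback.lift (f := T.hom) (g := (tfst Z.obj A).left) (tfst (T' T) A).left
      (tmap (vT T) A).left (congrArg (fun k ↦ k.left) (tmap_tfst (vT T) A)).symm
  have hφ1 (T) : φ T ≫ (tfst (T' T) A).left = pullback.fst T.hom (tfst Z.obj A).left :=
    pullback.lift_fst (f := (T' T).hom) (g := A.obj.hom) _ _ _
  have hφ2 (T) : φ T ≫ (tsnd (T' T) A).left =
      pullback.snd T.hom (tfst Z.obj A).left ≫ (tsnd Z.obj A).left :=
    pullback.lift_snd (f := (T' T).hom) (g := A.obj.hom) _ _ _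
  have hψ1 (T) : ψ T ≫ pullback.fst T.hom (tfst Z.obj A).left = (tfst (T' T) A).left :=
    pullback.lift_fst _ _ _
  have hψ2 (T) : ψ T ≫ pullback.snd T.hom (tfst Z.obj A).left = (tmap (vT T) A).left :=
    pullback.lift_snd _ _ _
  have hext {X : Over S} {W : C} (a b : W ⟶ (tensor X A).left)
      (h1 : a ≫ (tfst X A).left = b ≫ (tfst X A).left)
      (h2 : a ≫ (tsnd X A).left = b ≫ (tsnd X A).left) : a = b :=
    pullback.hom_ext (f := X.hom) (g := A.obj.hom) h1 h2
  have hφv (T) : φ T ≫ (tmap (vT T) A).left = pullback.snd T.hom (tfst Z.obj A).left := by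
    apply hext
    · have h := congrArg (fun k ↦ k.left) (tmap_tfst (vT T) A)
      have h' : (tmap (vT T) A).left ≫ (tfst Z.obj A).left = (tfst (T' T) A).left ≫ T.hom := h
      rw [Category.assoc, h', ← Category.assoc, hφ1, pullback.condition]
    · have h' : (tmap (vT T) A).left ≫ (tsnd Z.obj A).left = (tsnd (T' T) A).left :=
        congrArg (fun k ↦ k.left) (tmap_tsnd (vT T) A)
      rw [Category.assoc, h', hφ2]
  have hφψ (T) : φ T ≫ ψ T = 𝟙 _ := by
    refine pullback.hom_ext (f := T.hom) (g := (tfst Z.obj A).left) ?_ ?_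
    · rw [Category.assoc, hψ1, hφ1]
      exact (Category.id_comp _).symm
    · rw [Category.assoc, hψ2, hφv]
      exact (Category.id_comp _).symm
  have hψφ (T) : ψ T ≫ φ T = 𝟙 _ := by
    apply hext
    · rw [Category.assoc, hφ1, hψ1, Category.id_comp]
    · rw [Category.assoc, hφ2, ← Category.assoc, hψ2, Category.id_comp]
      exact congrArg (fun k ↦ k.left) (tmap_tsnd (vT T) A)
  -- the universal element
  let M : Over Z.obj.left := Over.mk d.left
  let κ : T' M ⟶ K := Over.homMk (𝟙 _) ((Category.id_comp _).trans (Over.w d).symm)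
  have hκd : κ ≫ d = vT M := by
    ext
    exact Category.id_comp _
  let x : F.obj M ⟶ Q.obj := Over.homMk
    (pullback.lift (f := z.left) (g := r.left) (pullback.snd M.hom (tfst Z.obj A).left)
      (φ M ≫ (tmap κ A ≫ k).left) (by
        have h : (tmap κ A ≫ k) ≫ r = tmap (vT M) A ≫ z := by
          rw [Category.assoc, hk, ← hκd, tmap, tmap, tmap, Functor.map_comp, Functor.map_comp,
            Category.assoc]
        have h' : (tmap κ A ≫ k).left ≫ r.left = (tmap (vT M) A).left ≫ z.left :=
          congrArg (fun k ↦ k.left) h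
        rw [Category.assoc, h', ← Category.assoc, hφv]))
    (pullback.lift_fst (f := z.left) (g := r.left) _ _ _)
  have hx2 : x.left ≫ pullback.snd z.left r.left = φ M ≫ (tmap κ A ≫ k).left :=
    pullback.lift_snd (f := z.left) (g := r.left) _ _ _
  let m {T : Over Z.obj.left} (t : T ⟶ M) : T' T ⟶ K := Over.homMk t.left (by
    have h := Over.w t
    change t.left ≫ d.left = T.hom at h
    change t.left ≫ K.hom = T.hom ≫ Z.obj.hom
    rw [← h, Category.assoc, Over.w d])
  have hm {T : Over Z.obj.left} (t : T ⟶ M) : m t ≫ d = vT T := by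
    ext
    exact Over.w t
  have hFφ {T : Over Z.obj.left} (t : T ⟶ M) :
      (F.map t).left ≫ φ M ≫ (tmap κ A).left = φ T ≫ (tmap (m t) A).left := by
    have a1 : (F.map t).left ≫ pullback.fst M.hom (tfst Z.obj A).left =
      pullback.fst T.hom (tfst Z.obj A).left ≫ t.left := pullback.lift_fst _ _ _
    have a2 : (F.map t).left ≫ pullback.snd M.hom (tfst Z.obj A).left =
      pullback.snd T.hom (tfst Z.obj A).left := pullback.lift_snd _ _ _
    have b1 : (tmap κ A).left ≫ (tfst K A).left = (tfst (T' M) A).left ≫ 𝟙 _ :=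
      congrArg (fun k ↦ k.left) (tmap_tfst κ A)
    have b2 : (tmap κ A).left ≫ (tsnd K A).left = (tsnd (T' M) A).left :=
      congrArg (fun k ↦ k.left) (tmap_tsnd κ A)
    have c1 : (tmap (m t) A).left ≫ (tfst K A).left = (tfst (T' T) A).left ≫ t.left :=
      congrArg (fun k ↦ k.left) (tmap_tfst (m t) A)
    have c2 : (tmap (m t) A).left ≫ (tsnd K A).left = (tsnd (T' T) A).left :=
      congrArg (fun k ↦ k.left) (tmap_tsnd (m t) A)
    apply hext
    · rw [Category.assoc, Category.assoc, Category.assoc, b1, c1, reassoc_of% hφ1,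
        Category.comp_id, ← Category.assoc (φ T), hφ1]
      exact a1
    · rw [Category.assoc, Category.assoc, Category.assoc, b2, c2, hφ2, hφ2, ← a2, Category.assoc]
  have hFx {T : Over Z.obj.left} (t : T ⟶ M) :
      (F.map t ≫ x).left ≫ pullback.snd z.left r.left = φ T ≫ (tmap (m t) A ≫ k).left := by
    have h1 : (F.map t ≫ x).left ≫ pullback.snd z.left r.left =
      (F.map t).left ≫ x.left ≫ pullback.snd z.left r.left := Category.assoc _ _ _
    have h2 : (tmap κ A ≫ k).left = (tmap κ A).left ≫ k.left := rfl
    have h3 : (tmap (m t) A ≫ k).left = (tmap (m t) A).left ≫ k.left := rfl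
    rw [h1, hx2, h2, h3, ← Category.assoc (φ M), ← Category.assoc, hFφ, Category.assoc]
  have hbij (T : Over Z.obj.left) : Function.Bijective (fun t : T ⟶ M ↦ F.map t ≫ x) := by
    constructor
    · intro t t' h
      have h1 : φ T ≫ (tmap (m t) A ≫ k).left = φ T ≫ (tmap (m t') A ≫ k).left := by
        rw [← hFx, ← hFx]
        exact congrArg (fun f ↦ f.left ≫ _) h
      have h2 : tmap (m t) A ≫ k = tmap (m t') A ≫ k := by
        ext
        have := congrArg (ψ T ≫ ·) h1
        simpa only [← Category.assoc, hψφ, Category.id_comp] using this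
      have h3 := huniq _ (m t) (m t') ((hm t).trans (hm t').symm) h2
      ext
      exact congrArg (fun f ↦ f.left) h3
    · intro y
      let w : tensor (T' T) A ⟶ P.obj := Over.homMk (ψ T ≫ y.left ≫ pullback.snd z.left r.left) (by
        have e1 : y.left ≫ pullback.fst z.left r.left = pullback.snd T.hom (tfst Z.obj A).left :=
          Over.w y
        rw [← Over.w r, Category.assoc, Category.assoc, ← reassoc_of%
          (pullback.condition (f := z.left) (g := r.left)), reassoc_of% e1, reassoc_of% hψ2]
        exact (Category.assoc _ _ _).symm.trans (Over.w (tmap (vT T) A ≫ z)))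
      have hw : w ≫ r = tmap (vT T) A ≫ z := by
        ext
        change (ψ T ≫ y.left ≫ pullback.snd z.left r.left) ≫ r.left =
          (tmap (vT T) A).left ≫ z.left
        have e1 : y.left ≫ pullback.fst z.left r.left = pullback.snd T.hom (tfst Z.obj A).left :=
          Over.w y
        rw [Category.assoc, Category.assoc, ← pullback.condition, reassoc_of% e1, reassoc_of% hψ2]
      obtain ⟨n, hn1, hn2⟩ := hex (T' T) (vT T) w hw
      let t : T ⟶ M := Over.homMk n.left (congrArg (fun f ↦ f.left) hn1)
      have hmt : m t = n := rfl
      refine ⟨t, ?_⟩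
      ext
      refine pullback.hom_ext (f := z.left) (g := r.left) ?_ ?_
      · exact (Over.w (F.map t ≫ x)).trans (Over.w y).symm
      · rw [hFx, hmt, hn2]
        change φ T ≫ ψ T ≫ y.left ≫ _ = _
        rw [← Category.assoc, hφψ, Category.id_comp]
  let e : M ≅ (piObj (tfst Z.obj A).left hπ Q).obj :=
    Functor.RepresentableBy.uniqueUpToIso (F := F.op ⋙ yoneda.obj Q.obj)
      { homEquiv := fun {T} ↦ Equiv.ofBijective _ (hbij T)
        homEquiv_comp := fun g f ↦ by
          change F.map (g ≫ f) ≫ x = F.map g ≫ F.map f ≫ x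
          rw [F.map_comp, Category.assoc] }
      { homEquiv := fun {T} ↦ piEquiv (tfst Z.obj A).left hπ Q T
        homEquiv_comp := fun g f ↦ piEquiv_comp (tfst Z.obj A).left hπ Q g f }
  have he : e.hom.left ≫ (piObj (tfst Z.obj A).left hπ Q).obj.hom = d.left := Over.w e.hom
  have : IsIso e.hom.left := ((Over.forget _).mapIso e).isIso_hom
  rw [← he]
  exact (MorphismProperty.cancel_left_of_respectsIso (fib (C := C)) _ _).2
    (piObj (tfst Z.obj A).left hπ Q).property


/-- The morphism `(∂₀, ∂₁)_*` from the internal hom into a path object is a fibration. -/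
lemma fib_postcomp_pathObject (A : FibrantSlice S) {B : FibrantSlice S} (P : PathObject B) :
    fib (tlift (X := (ihom A B).obj) (A := ihom A B)
      (postcomp A P.fst.hom) (postcomp A P.snd.hom)).left := by
  let H := ihom A B
  refine fib_of_universal (A := A) (P := P.obj) (D := prodObj B B) (Z := prodObj H H)
    (tlift (X := B.obj) (A := B) P.fst.hom P.snd.hom) (fib_pathObject_tlift P) _
    (tlift (X := B.obj) (A := B) (uncurry (tfst H.obj H)) (uncurry (tsnd H.obj H)))
    (uncurry (𝟙 _)) ?_ ?_ ?_
  · rw [comp_tlift, comp_tlift, ← uncurry_comp, ← uncurry_comp, tlift_tfst, tlift_tsnd,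
      postcomp, postcomp, uncurry_curry, uncurry_curry]
  · intro X v w hw
    rw [comp_tlift, comp_tlift, ← uncurry_comp, ← uncurry_comp] at hw
    have h1 := congrArg (· ≫ tfst B.obj B) hw
    have h2 := congrArg (· ≫ tsnd B.obj B) hw
    simp only [tlift_tfst, tlift_tsnd] at h1 h2
    refine ⟨curry w, ?_, ?_⟩
    · apply tensor_hom_ext
      · rw [Category.assoc, tlift_tfst, curry_postcomp, h1, curry_uncurry]
      · rw [Category.assoc, tlift_tsnd, curry_postcomp, h2, curry_uncurry]
    · rw [← uncurry_comp, Category.comp_id, uncurry_curry]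
  · intro X m m' _ h
    rw [← uncurry_comp, ← uncurry_comp, Category.comp_id, Category.comp_id] at h
    rw [← curry_uncurry m, h, curry_uncurry]

end InternalHom

section EqObj

variable {C : Type u} [Category.{v} C] [Tribe C] [HasDependentProducts C] {S : C}

/-- The bottom morphism `(c, const)` in the square defining `rInv`. -/
noncomputable def rInvBase (A B : FibrantSlice S) :
    (prodObj (ihom A B) (ihom B A)).obj ⟶ (prodObj (ihom B B) (ihom B B)).obj :=
  tlift (icomp (tfst (ihom A B).obj (ihom B A)) (tsnd (ihom A B).obj (ihom B A))) (constId _ B)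

/-- The object of morphisms `A ⟶ B` with a right homotopy inverse, for a path object of `B`. -/
noncomputable def rInv (A : FibrantSlice S) {B : FibrantSlice S} (Q : PathObject B) :
    FibrantSlice S :=
  pbObj (rInvBase A B)
    (tlift (X := (ihom B B).obj) (A := ihom B B) (postcomp B Q.fst.hom) (postcomp B Q.snd.hom))
    (fib_postcomp_pathObject B Q)

/-- The projection to `Hom(A, B)`. -/
noncomputable def rInvProj (A : FibrantSlice S) {B : FibrantSlice S} (Q : PathObject B) :
    (rInv A Q).obj ⟶ (ihom A B).obj :=
  pbFst _ _ _ ≫ tfst (ihom A B).obj (ihom B A)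

/-- The bottom morphism `(c, const)` in the square defining `lInv`. -/
noncomputable def lInvBase (A B : FibrantSlice S) :
    (prodObj (ihom B A) (ihom A B)).obj ⟶ (prodObj (ihom A A) (ihom A A)).obj :=
  tlift (icomp (tfst (ihom B A).obj (ihom A B)) (tsnd (ihom B A).obj (ihom A B))) (constId _ A)

/-- The object of morphisms `A ⟶ B` with a left homotopy inverse, for a path object of `A`. -/
noncomputable def lInv {A : FibrantSlice S} (P : PathObject A) (B : FibrantSlice S) :
    FibrantSlice S :=
  pbObj (lInvBase A B)
    (tlift (X := (ihom A A).obj) (A := ihom A A) (postcomp A P.fst.hom) (postcomp A P.snd.hom))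
    (fib_postcomp_pathObject A P)

/-- The projection to `Hom(A, B)`. -/
noncomputable def lInvProj {A : FibrantSlice S} (P : PathObject A) (B : FibrantSlice S) :
    (lInv P B).obj ⟶ (ihom A B).obj :=
  pbFst _ _ _ ≫ tsnd (ihom B A).obj (ihom A B)

lemma fib_lInvProj_left {A : FibrantSlice S} (P : PathObject A) (B : FibrantSlice S) :
    fib (lInvProj P B).left :=
  MorphismProperty.comp_mem (fib (C := C)) _ _ (fib_pbFst_left _ _ _)
    (fib_tsnd_left (ihom B A) (ihom A B))

/-- The object of equivalences over `S` between two fibrations `A` and `B` over `S`, formed with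
path objects of `A` and `B` in the fibrant slice over `S`. -/
noncomputable def eqObj {A B : FibrantSlice S} (P : PathObject A) (Q : PathObject B) :
    FibrantSlice S :=
  pbObj (rInvProj A Q) (lInvProj P B) (fib_lInvProj_left P B)

/-- The morphism into `rInv A Q` given by `e` and a strict right inverse `g`, with the constant
homotopy. -/
noncomputable def rInvLift {A B : FibrantSlice S} (Q : PathObject B) {X : Over S}
    (e : tensor X A ⟶ B.obj) (g : tensor X B ⟶ A.obj)
    (heg : tlift (tfst X B) g ≫ e = tsnd X B) : X ⟶ (rInv A Q).obj :=
  pbLift _ (tlift (curry e) (curry g)) (curry (tsnd X B ≫ Q.refl.hom)) (by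
    have h1 : Q.refl.hom ≫ Q.fst.hom = 𝟙 _ := congrArg (fun k ↦ k.hom) Q.refl_fst
    have h2 : Q.refl.hom ≫ Q.snd.hom = 𝟙 _ := congrArg (fun k ↦ k.hom) Q.refl_snd
    rw [rInvBase, comp_tlift, comp_tlift, comp_icomp, tlift_tfst, tlift_tsnd, icomp_curry, heg,
      comp_constId, curry_postcomp, curry_postcomp, Category.assoc, Category.assoc, h1, h2,
      Category.comp_id, constId])

/-- The morphism into `lInv P B` given by `e` and a strict left inverse `g`, with the constant
homotopy. -/
noncomputable def lInvLift {A B : FibrantSlice S} (P : PathObject A) {X : Over S}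
    (e : tensor X A ⟶ B.obj) (g : tensor X B ⟶ A.obj)
    (hge : tlift (tfst X A) e ≫ g = tsnd X A) : X ⟶ (lInv P B).obj :=
  pbLift _ (tlift (curry g) (curry e)) (curry (tsnd X A ≫ P.refl.hom)) (by
    have h1 : P.refl.hom ≫ P.fst.hom = 𝟙 _ := congrArg (fun k ↦ k.hom) P.refl_fst
    have h2 : P.refl.hom ≫ P.snd.hom = 𝟙 _ := congrArg (fun k ↦ k.hom) P.refl_snd
    rw [lInvBase, comp_tlift, comp_tlift, comp_icomp, tlift_tfst, tlift_tsnd, icomp_curry, hge,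
      comp_constId, curry_postcomp, curry_postcomp, Category.assoc, Category.assoc, h1, h2,
      Category.comp_id, constId])

lemma rInvLift_rInvProj {A B : FibrantSlice S} (Q : PathObject B) {X : Over S}
    (e : tensor X A ⟶ B.obj) (g : tensor X B ⟶ A.obj)
    (heg : tlift (tfst X B) g ≫ e = tsnd X B) :
    rInvLift Q e g heg ≫ rInvProj A Q = curry e :=
  (Category.assoc _ _ _).symm.trans
    ((congrArg (· ≫ tfst (ihom A B).obj (ihom B A)) (pbLift_pbFst _ _ _ _)).trans
      (tlift_tfst _ _))

lemma lInvLift_lInvProj {A B : FibrantSlice S} (P : PathObject A) {X : Over S}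
    (e : tensor X A ⟶ B.obj) (g : tensor X B ⟶ A.obj)
    (hge : tlift (tfst X A) e ≫ g = tsnd X A) :
    lInvLift P e g hge ≫ lInvProj P B = curry e :=
  (Category.assoc _ _ _).symm.trans
    ((congrArg (· ≫ tsnd (ihom B A).obj (ihom A B)) (pbLift_pbFst _ _ _ _)).trans
      (tlift_tsnd _ _))

/-- The morphism into the object of equivalences given by mutually inverse isomorphisms `e` and `g`
over `X`, with `g` as both homotopy inverses and with constant homotopies. -/
noncomputable def eqLift {A B : FibrantSlice S} (P : PathObject A) (Q : PathObject B) {X : Over S}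
    (e : tensor X A ⟶ B.obj) (g : tensor X B ⟶ A.obj)
    (hge : tlift (tfst X A) e ≫ g = tsnd X A) (heg : tlift (tfst X B) g ≫ e = tsnd X B) :
    X ⟶ (eqObj P Q).obj :=
  pbLift _ (rInvLift Q e g heg) (lInvLift P e g hge)
    ((rInvLift_rInvProj Q e g heg).trans (lInvLift_lInvProj P e g hge).symm)

end EqObj

section Univalent

variable {C : Type u} [Category.{v} C] [Tribe C]

/-- The pullback of a fibration `p` along `r`, as a fibration over `S`. -/
noncomputable def baseChange {S E B : C} (r : S ⟶ B) (p : E ⟶ B) (hp : fib p) : FibrantSlice S :=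
  haveI := hasPullback r p hp
  FibrantSlice.mk (pullback.fst r p) (fib_pullback_fst r p hp)

/-- The projection of the pullback of `p` along `r` to the domain of `p`. -/
noncomputable def baseChangeProj {S E B : C} (r : S ⟶ B) (p : E ⟶ B) (hp : fib p) :
    (baseChange r p hp).obj.left ⟶ E :=
  haveI := hasPullback r p hp
  pullback.snd r p

lemma baseChange_condition {S E B : C} (r : S ⟶ B) (p : E ⟶ B) (hp : fib p) :
    (baseChange r p hp).obj.hom ≫ r = baseChangeProj r p hp ≫ p :=
  haveI := hasPullback r p hp
  pullback.condition

/-- If `r` and `r'` agree on `X`, the identity of the common pullback of `p` to `X`, written as a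
morphism over `S` from the product of `X` with the pullback of `p` along `r` to the pullback of `p`
along `r'`. -/
noncomputable def idTransport {S E B : C} (r r' : S ⟶ B) (p : E ⟶ B) (hp : fib p) (X : Over S)
    (hX : X.hom ≫ r = X.hom ≫ r') :
    tensor X (baseChange r p hp) ⟶ (baseChange r' p hp).obj :=
  haveI := hasPullback r' p hp
  Over.homMk (pullback.lift (f := r') (g := p) ((tfst X (baseChange r p hp)).left ≫ X.hom)
    ((tsnd X (baseChange r p hp)).left ≫ baseChangeProj r p hp) (by
      have h1 : (tfst X (baseChange r p hp)).left ≫ X.hom =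
        (tsnd X (baseChange r p hp)).left ≫ (baseChange r p hp).obj.hom :=
        (Over.w (tfst X (baseChange r p hp))).trans (Over.w (tsnd X (baseChange r p hp))).symm
      rw [Category.assoc, Category.assoc, ← baseChange_condition, ← reassoc_of% h1, hX]))
    ((pullback.lift_fst (f := r') (g := p) _ _ _).trans (Over.w (tfst X (baseChange r p hp))))

lemma idTransport_proj {S E B : C} (r r' : S ⟶ B) (p : E ⟶ B) (hp : fib p) (X : Over S)
    (hX : X.hom ≫ r = X.hom ≫ r') :
    (idTransport r r' p hp X hX).left ≫ baseChangeProj r' p hp =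
      (tsnd X (baseChange r p hp)).left ≫ baseChangeProj r p hp :=
  haveI := hasPullback r' p hp
  pullback.lift_snd (f := r') (g := p) _ _ _

lemma idTransport_idTransport {S E B : C} (r r' : S ⟶ B) (p : E ⟶ B) (hp : fib p) (X : Over S)
    (hX : X.hom ≫ r = X.hom ≫ r') :
    tlift (tfst X (baseChange r p hp)) (idTransport r r' p hp X hX) ≫
      idTransport r' r p hp X hX.symm = tsnd X (baseChange r p hp) := by
  have := hasPullback r p hp
  let a : tensor X (baseChange r p hp) ⟶ tensor X (baseChange r' p hp) :=
    tlift (tfst X (baseChange r p hp)) (idTransport r r' p hp X hX)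
  change a ≫ _ = _
  ext
  refine pullback.hom_ext (f := r) (g := p) ?_ ?_
  · exact (Over.w (a ≫ idTransport r' r p hp X hX.symm)).trans
      (Over.w (tsnd X (baseChange r p hp))).symm
  · have h2 : a.left ≫ (tsnd X (baseChange r' p hp)).left = (idTransport r r' p hp X hX).left :=
      congrArg (fun k ↦ k.left)
        (tlift_tsnd (tfst X (baseChange r p hp)) (idTransport r r' p hp X hX))
    change (a.left ≫ (idTransport r' r p hp X hX.symm).left) ≫ baseChangeProj r p hp =
      (tsnd X (baseChange r p hp)).left ≫ baseChangeProj r p hp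
    rw [Category.assoc, idTransport_proj, ← Category.assoc, h2, idTransport_proj]

variable [HasDependentProducts C]

/-- The morphism `δ` over `B ⨯ B` from the diagonal of `B` to the object of equivalences between
the pullbacks of `p` along the two projections, given by the identity of `p`. -/
noncomputable def delta {E B : C} (p : E ⟶ B) (hp : fib p)
    (P : PathObject (baseChange (prod.fst : B ⨯ B ⟶ B) p hp))
    (Q : PathObject (baseChange (prod.snd : B ⨯ B ⟶ B) p hp)) :
    Over.mk (diag B) ⟶ (eqObj P Q).obj :=
  eqLift P Q (idTransport prod.fst prod.snd p hp (Over.mk (diag B))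
      ((prod.lift_fst _ _).trans (prod.lift_snd _ _).symm))
    (idTransport prod.snd prod.fst p hp (Over.mk (diag B))
      ((prod.lift_snd _ _).trans (prod.lift_fst _ _).symm))
    (idTransport_idTransport _ _ _ _ _ _) (idTransport_idTransport _ _ _ _ _ _)

/-- A fibration `p : E ⟶ B` is univalent if the morphism `δ` from `B` to its object of equivalences
is a homotopy equivalence. (The choice of path objects is immaterial: objects of equivalences for
different choices are homotopy equivalent, compatibly with `δ`.) -/
def IsUnivalent {E B : C} (p : E ⟶ B) : Prop :=
  ∃ (hp : fib p) (P : PathObject (baseChange (prod.fst : B ⨯ B ⟶ B) p hp))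
    (Q : PathObject (baseChange (prod.snd : B ⨯ B ⟶ B) p hp)),
    IsHomotopyEquiv (delta p hp P Q).left

end Univalent

end Tribe

/-! The object of equivalences is stable under base change. Hence `Eq_Y(X)` is the pullback of
`Eq_B(E)` along `f × f : Y ⨯ Y ⟶ B ⨯ B`, which is a fibration because `f` is one, and the projection
`Eq_Y(X) ⟶ Eq_B(E)` carries `δ_q` to `f ≫ δ_p` (`exists_isPullback_delta`). Pulling back the whole
factorisation `B ⟶ Eq_B(E) ⟶ B ⨯ B` of the diagonal along `f × f` gives `Y ×_B Y ⟶ Eq_Y(X) ⟶ Y ⨯ Y`.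
Its first morphism `κ` is a base change of `δ_p` along a fibration, so univalence of `p` makes `κ` a
homotopy equivalence. Since `δ_q` is the diagonal `Y ⟶ Y ×_B Y` followed by `κ`, two-out-of-three
shows that `δ_q` is an equivalence exactly when the diagonal of `f` is
(`isHomotopyEquiv_iff_diagonal`). For a fibration this is the same as being a homotopy monomorphism
(`isHomotopyMono_iff`).

Three ingredients support this. The homotopy theory of a tribe: homotopy is a congruence, so
equivalences are the morphisms inverted in a quotient category, and they are stable under pullback
along fibrations (`IsHomotopyEquiv.of_isPullback`). Representability: `eqObj` classifies the data
`EqDatum` over arbitrary bases, and such data correspond bijectively under base change once the path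
objects are pulled back too (`exists_isBaseChange`, `exists_isCart_eqObj`). Independence of path
objects (`exists_isHomotopyEquiv_eqObj`): univalence of `q` supplies some path objects, not
necessarily the pulled-back ones. Only here is it used that dependent products preserve homotopy
equivalences. -/

namespace Tribe

/-! ### Homotopies and homotopy equivalences in a tribe -/

section HomotopyTheory

attribute [local simp] prod.lift_fst prod.lift_snd prod.lift_fst_assoc prod.lift_snd_assoc
  pullback.lift_fst pullback.lift_snd pullback.lift_fst_assoc pullback.lift_snd_assoc

variable {C : Type u} [Category.{v} C] [Tribe C]

lemma fib_of_isIso {X Y : C} (f : X ⟶ Y) [IsIso f] : fib f :=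
  MorphismProperty.of_isPullback (IsPullback.of_horiz_isIso
    (⟨by simp⟩ : CommSq f f (𝟙 _) (𝟙 _))) (MorphismProperty.id_mem _ _)

lemma fib_comp {X Y Z : C} {f : X ⟶ Y} {g : Y ⟶ Z} (hf : fib f) (hg : fib g) : fib (f ≫ g) :=
  MorphismProperty.comp_mem _ _ _ hf hg

lemma fib_prod_fst (A B : C) : fib (prod.fst : A ⨯ B ⟶ A) := by
  have sq : IsPullback (prod.snd : A ⨯ B ⟶ B) prod.fst (terminal.from B) (terminal.from A) :=
    (IsPullback.of_is_product' (prodIsProd A B) terminalIsTerminal).flip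
  exact MorphismProperty.of_isPullback sq (fib_from B)

lemma fib_prod_snd (A B : C) : fib (prod.snd : A ⨯ B ⟶ B) := by
  have sq : IsPullback (prod.fst : A ⨯ B ⟶ A) prod.snd (terminal.from A) (terminal.from B) :=
    IsPullback.of_is_product' (prodIsProd A B) terminalIsTerminal
  exact MorphismProperty.of_isPullback sq (fib_from A)

lemma exists_lift {A B X Y : C} {i : A ⟶ B} {p : X ⟶ Y} (hi : (fib (C := C)).llp i) (hp : fib p)
    (f : A ⟶ X) (g : B ⟶ Y) (w : f ≫ p = i ≫ g) : ∃ l : B ⟶ X, i ≫ l = f ∧ l ≫ p = g := by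
  have := hi p hp
  have sq : CommSq f i p g := ⟨w⟩
  exact ⟨sq.lift, sq.fac_left, sq.fac_right⟩

namespace PathObject

variable {A : C} (P : PathObject A)

lemma fib_fst : fib P.fst := by
  rw [← prod.lift_fst P.fst P.snd]
  exact fib_comp P.fib_lift (fib_prod_fst A A)

lemma fib_snd : fib P.snd := by
  rw [← prod.lift_snd P.fst P.snd]
  exact fib_comp P.fib_lift (fib_prod_snd A A)

/-- Anodyne morphisms lift against the fibration `(fst, snd)` of a path object. -/
lemma exists_lift {X Y : C} {i : X ⟶ Y} (hi : (fib (C := C)).llp i) (h : X ⟶ P.obj) (f g : Y ⟶ A)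
    (hf : h ≫ P.fst = i ≫ f) (hg : h ≫ P.snd = i ≫ g) :
    ∃ l : Y ⟶ P.obj, i ≫ l = h ∧ l ≫ P.fst = f ∧ l ≫ P.snd = g := by
  obtain ⟨l, h1, h2⟩ := Tribe.exists_lift hi P.fib_lift h (prod.lift f g)
    (by rw [prod.comp_lift, prod.comp_lift, hf, hg])
  refine ⟨l, h1, ?_, ?_⟩
  · simpa using congrArg (· ≫ prod.fst) h2
  · simpa using congrArg (· ≫ prod.snd) h2

/-- The path object with the two endpoints exchanged. -/
def symm : PathObject A where
  obj := P.obj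
  refl := P.refl
  fst := P.snd
  snd := P.fst
  refl_fst := P.refl_snd
  refl_snd := P.refl_fst
  anodyne_refl := P.anodyne_refl
  fib_lift := by
    have h : prod.lift P.snd P.fst = prod.lift P.fst P.snd ≫ (prod.braiding A A).hom := by
      apply Limits.prod.hom_ext <;> simp
    rw [h]
    exact fib_comp P.fib_lift (fib_of_isIso _)

/-- A morphism between path objects of the same object, compatible with all structure maps. -/
lemma exists_comparison (Q : PathObject A) :
    ∃ c : P.obj ⟶ Q.obj, P.refl ≫ c = Q.refl ∧ c ≫ Q.fst = P.fst ∧ c ≫ Q.snd = P.snd :=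
  Q.exists_lift P.anodyne_refl Q.refl P.fst P.snd (by rw [P.refl_fst, Q.refl_fst])
    (by rw [P.refl_snd, Q.refl_snd])

end PathObject

/-- Any two path objects of `B` are connected by a morphism respecting endpoints, so a homotopy can
be moved to whichever path object is at hand. -/
lemma Homotopic.exists_homotopy {A B : C} {f g : A ⟶ B} (h : Homotopic f g) (Q : PathObject B) :
    ∃ k : A ⟶ Q.obj, k ≫ Q.fst = f ∧ k ≫ Q.snd = g := by
  obtain ⟨P, k, rfl, rfl⟩ := h
  obtain ⟨c, -, h1, h2⟩ := P.exists_comparison Q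
  exact ⟨k ≫ c, by rw [Category.assoc, h1], by rw [Category.assoc, h2]⟩

lemma Homotopic.refl {A B : C} (f : A ⟶ B) : Homotopic f f := by
  obtain ⟨P⟩ := nonempty_pathObject B
  exact ⟨P, f ≫ P.refl, by rw [Category.assoc, P.refl_fst, Category.comp_id],
    by rw [Category.assoc, P.refl_snd, Category.comp_id]⟩

lemma Homotopic.symm {A B : C} {f g : A ⟶ B} (h : Homotopic f g) : Homotopic g f := by
  obtain ⟨P, k, hf, hg⟩ := h
  exact ⟨P.symm, k, hg, hf⟩

lemma Homotopic.trans {A B : C} {f g k : A ⟶ B} (h : Homotopic f g) (h' : Homotopic g k) :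
    Homotopic f k := by
  obtain ⟨P, a, rfl, rfl⟩ := h
  obtain ⟨b, hb, rfl⟩ := h'.exists_homotopy P
  have := hasPullback P.fst P.snd P.fib_snd
  have := hasPullback P.snd P.fst P.fib_fst
  -- the path `x` followed by the constant path at its endpoint
  let j : P.obj ⟶ pullback P.snd P.fst := pullback.lift (𝟙 _) (P.snd ≫ P.refl)
    (by rw [Category.id_comp, Category.assoc, P.refl_fst, Category.comp_id])
  -- The pullback consists of composable pairs of paths, and `j` picks out those whose second path
  -- is constant. So `j` is a base change of `P.refl` along a fibration, hence anodyne.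
  -- Concatenation `m` is then the extension along `j` of the identity on first paths.
  have sq : IsPullback j P.snd (pullback.snd P.snd P.fst) P.refl := by
    refine IsPullback.of_right (h₁₂ := pullback.fst P.snd P.fst) (h₂₂ := P.fst)
      (v₁₃ := P.snd) ?_ (by simp [j]) (IsPullback.of_hasPullback _ _)
    simpa [j, P.refl_fst] using IsPullback.of_horiz_isIso
      (⟨by simp⟩ : CommSq (𝟙 P.obj) P.snd P.snd (𝟙 B))
  have hj : (fib (C := C)).llp j :=
    anodyne_of_isPullback sq (fib_pullback_snd _ _ P.fib_snd) P.anodyne_refl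
  obtain ⟨m, -, h1, h2⟩ := P.exists_lift hj (𝟙 _) (pullback.fst P.snd P.fst ≫ P.fst)
    (pullback.snd P.snd P.fst ≫ P.snd) (by simp [j]) (by simp [j, P.refl_snd])
  exact ⟨P, pullback.lift a b hb.symm ≫ m, by simp [h1], by simp [h2]⟩

lemma Homotopic.comp_left {A B D : C} (u : A ⟶ B) {f g : B ⟶ D} (h : Homotopic f g) :
    Homotopic (u ≫ f) (u ≫ g) := by
  obtain ⟨P, k, rfl, rfl⟩ := h
  exact ⟨P, u ≫ k, Category.assoc _ _ _, Category.assoc _ _ _⟩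

/-- Lifting the anodyne `P.refl` against the endpoint fibration of a path object of `D` extends `u`
to paths, with constant paths sent to constant paths. -/
lemma Homotopic.comp_right {A B D : C} {f g : A ⟶ B} (u : B ⟶ D) (h : Homotopic f g) :
    Homotopic (f ≫ u) (g ≫ u) := by
  obtain ⟨P, k, rfl, rfl⟩ := h
  obtain ⟨Q⟩ := nonempty_pathObject D
  obtain ⟨l, -, h1, h2⟩ := Q.exists_lift P.anodyne_refl (u ≫ Q.refl) (P.fst ≫ u) (P.snd ≫ u)
    (by rw [Category.assoc, Q.refl_fst, ← Category.assoc, P.refl_fst]; simp)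
    (by rw [Category.assoc, Q.refl_snd, ← Category.assoc, P.refl_snd]; simp)
  exact ⟨Q, k ≫ l, by rw [Category.assoc, h1, Category.assoc],
    by rw [Category.assoc, h2, Category.assoc]⟩

variable (C) in
/-- The homotopy relation on the morphisms of a tribe. -/
def homotopyRel : HomRel C := fun _ _ f g ↦ Homotopic f g

instance : Congruence (homotopyRel C) where
  equivalence := ⟨Homotopic.refl, Homotopic.symm, Homotopic.trans⟩
  comp_left := Homotopic.comp_left
  comp_right := Homotopic.comp_right

variable (C) in
/-- The functor from a tribe to its homotopy category. -/
abbrev toHo : C ⥤ Quotient (homotopyRel C) := Quotient.functor _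

lemma toHo_map_eq_iff {A B : C} (f g : A ⟶ B) : (toHo C).map f = (toHo C).map g ↔ Homotopic f g :=
  Quotient.functor_map_eq_iff _ _ _

/-- Isomorphisms in the quotient category lift to inverses up to homotopy because the quotient
functor is full and identifies exactly the homotopic morphisms. Two-out-of-three then becomes
formal. -/
lemma isHomotopyEquiv_iff {A B : C} (f : A ⟶ B) :
    IsHomotopyEquiv f ↔ IsIso ((toHo C).map f) := by
  constructor
  · rintro ⟨g, h1, h2⟩
    rw [← toHo_map_eq_iff, CategoryTheory.Functor.map_comp, CategoryTheory.Functor.map_id] at h1 h2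
    exact ⟨(toHo C).map g, h1, h2⟩
  · rintro ⟨g, h1, h2⟩
    obtain ⟨g, rfl⟩ := (toHo C).map_surjective g
    refine ⟨g, ?_, ?_⟩ <;>
      rw [← toHo_map_eq_iff, CategoryTheory.Functor.map_comp, CategoryTheory.Functor.map_id] <;>
      assumption

namespace IsHomotopyEquiv

variable {X Y Z : C} {f : X ⟶ Y} {g : Y ⟶ Z}

lemma of_isIso (f : X ⟶ Y) [IsIso f] : IsHomotopyEquiv f := by
  rw [isHomotopyEquiv_iff]
  infer_instance

lemma comp (hf : IsHomotopyEquiv f) (hg : IsHomotopyEquiv g) : IsHomotopyEquiv (f ≫ g) := by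
  rw [isHomotopyEquiv_iff] at *
  rw [CategoryTheory.Functor.map_comp]
  infer_instance

lemma of_comp_left (hf : IsHomotopyEquiv f) (h : IsHomotopyEquiv (f ≫ g)) :
    IsHomotopyEquiv g := by
  rw [isHomotopyEquiv_iff] at *
  rw [CategoryTheory.Functor.map_comp] at h
  exact IsIso.of_isIso_comp_left ((toHo C).map f) _

lemma of_comp_right (hg : IsHomotopyEquiv g) (h : IsHomotopyEquiv (f ≫ g)) :
    IsHomotopyEquiv f := by
  rw [isHomotopyEquiv_iff] at *
  rw [CategoryTheory.Functor.map_comp] at h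
  exact IsIso.of_isIso_comp_right _ ((toHo C).map g)

lemma comp_iff_right (hg : IsHomotopyEquiv g) : IsHomotopyEquiv (f ≫ g) ↔ IsHomotopyEquiv f :=
  ⟨hg.of_comp_right, fun hf ↦ hf.comp hg⟩

/-- If `m` and `t` have sections and `m ≫ t` is a homotopy equivalence, then so is `t`. -/
lemma of_sections {X Y Z : C} {m : X ⟶ Y} {t : Y ⟶ Z} {n : Y ⟶ X} (hn : n ≫ m = 𝟙 Y)
    (h : IsHomotopyEquiv (m ≫ t)) : IsHomotopyEquiv t := by
  refine of_comp_left ?_ h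
  rw [isHomotopyEquiv_iff] at *
  rw [CategoryTheory.Functor.map_comp] at h
  -- The composite `m ≫ t` becomes invertible, so `m` becomes a monomorphism; with the section `n`
  -- it is also a split epimorphism, hence invertible.
  have hmono : Mono ((toHo C).map m) := mono_of_mono _ ((toHo C).map t)
  have : IsSplitEpi ((toHo C).map m) :=
    ⟨⟨⟨(toHo C).map n, by
      rw [← CategoryTheory.Functor.map_comp, hn, CategoryTheory.Functor.map_id]⟩⟩⟩
  exact isIso_of_mono_of_isSplitEpi _

end IsHomotopyEquiv

/-- Anodyne morphisms are homotopy equivalences. -/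
lemma isHomotopyEquiv_of_anodyne {A B : C} {i : A ⟶ B} (hi : (fib (C := C)).llp i) :
    IsHomotopyEquiv i := by
  -- Since `A ⟶ 1` is a fibration, the anodyne `i` has a strict retraction `r`. A homotopy from `r ≫
  -- i` to the identity comes from extending the constant one on `A` along `i`.
  obtain ⟨r, hr, -⟩ := exists_lift hi (fib_from A) (𝟙 A) (terminal.from B) (Subsingleton.elim _ _)
  obtain ⟨P⟩ := nonempty_pathObject B
  obtain ⟨k, -, h1, h2⟩ := P.exists_lift hi (i ≫ P.refl) (r ≫ i) (𝟙 B)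
    (by simp [P.refl_fst, reassoc_of% hr]) (by simp [P.refl_snd])
  refine ⟨r, ?_, ⟨P, k, h1, h2⟩⟩
  rw [hr]
  exact Homotopic.refl _

/-- A fibration which is a homotopy equivalence has a section. -/
lemma exists_section {A D : C} {t : A ⟶ D} (ht : fib t) (h : IsHomotopyEquiv t) :
    ∃ s : D ⟶ A, s ≫ t = 𝟙 D := by
  obtain ⟨g, -, ⟨P, k, hk1, hk2⟩⟩ := h
  have := hasPullback P.fst t ht
  -- Path lifting for `t`: the pullback pairs a point of `A` with a path in `D` starting at its
  -- image, and `j` adjoins the constant path. As a base change of `P.refl` along a fibration, `j`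
  -- is anodyne, which yields the transport `l`. Transporting the homotopy inverse `g` along the
  -- homotopy `k` from `g ≫ t` to the identity makes it a strict section.
  let j : A ⟶ pullback P.fst t := pullback.lift (t ≫ P.refl) (𝟙 A)
    (by rw [Category.assoc, P.refl_fst, Category.comp_id, Category.id_comp])
  have sq : IsPullback j t (pullback.fst P.fst t) P.refl := by
    refine IsPullback.of_right (h₁₂ := pullback.snd P.fst t) (h₂₂ := P.fst)
      (v₁₃ := t) ?_ (by simp [j]) (IsPullback.of_hasPullback _ _).flip
    simpa [j, P.refl_fst] using IsPullback.of_horiz_isIso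
      (⟨by simp⟩ : CommSq (𝟙 A) t t (𝟙 D))
  have hj : (fib (C := C)).llp j :=
    anodyne_of_isPullback sq (fib_pullback_fst _ _ ht) P.anodyne_refl
  obtain ⟨l, -, hl⟩ := exists_lift hj ht (𝟙 A) (pullback.fst P.fst t ≫ P.snd)
    (by simp [j, P.refl_snd])
  exact ⟨pullback.lift k g hk1 ≫ l, by simp [hl, hk2]⟩

/-- A factorisation of a homotopy equivalence as an anodyne morphism followed by a fibration with a
section. -/
lemma exists_factorization {A D : C} {w : A ⟶ D} (hw : IsHomotopyEquiv w) :
    ∃ (M : C) (i : A ⟶ M) (t : M ⟶ D) (s : D ⟶ M), (fib (C := C)).llp i ∧ fib t ∧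
      i ≫ t = w ∧ s ≫ t = 𝟙 D ∧ IsHomotopyEquiv t := by
  obtain ⟨d⟩ := MorphismProperty.HasFactorization.nonempty_mapFactorizationData
    (W₁ := (fib (C := C)).llp) (W₂ := fib (C := C)) w
  have ht : IsHomotopyEquiv d.p :=
    (isHomotopyEquiv_of_anodyne d.hi).of_comp_left (by rwa [d.fac])
  obtain ⟨s, hs⟩ := exists_section d.hp ht
  exact ⟨d.Z, d.i, d.p, s, d.hi, d.hp, d.fac, hs, ht⟩

/-- Homotopy equivalences are stable under pullback along fibrations. -/
lemma IsHomotopyEquiv.of_isPullback {A A' D D' : C} {a : A' ⟶ A} {w' : A' ⟶ D'} {w : A ⟶ D}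
    {g : D' ⟶ D} (sq : IsPullback a w' w g) (hg : fib g) (hw : IsHomotopyEquiv w) :
    IsHomotopyEquiv w' := by
  -- pulling back a section of a fibration `t` which is a homotopy equivalence
  have key {M N : C} (t : M ⟶ N) (s : N ⟶ M) (hs : s ≫ t = 𝟙 N) {M' N' : C} {m : M' ⟶ M}
      {t' : M' ⟶ N'} {n : N' ⟶ N} (sq : IsPullback m t' t n) :
      ∃ s' : N' ⟶ M', s' ≫ t' = 𝟙 N' ∧ IsPullback n s' s m := by
    let s' : N' ⟶ M' := sq.lift (n ≫ s) (𝟙 N') (by rw [Category.assoc, hs]; simp)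
    have h2 : s' ≫ t' = 𝟙 N' := sq.lift_snd _ _ _
    refine ⟨s', h2, IsPullback.of_bot ?_ (sq.lift_fst _ _ _).symm sq⟩
    rw [h2, hs]
    exact IsPullback.of_vert_isIso ⟨by simp⟩
  have pb {M N N' : C} {t : M ⟶ N} (n : N' ⟶ N) (hn : fib n) :
      ∃ (M' : C) (m : M' ⟶ M) (t' : M' ⟶ N'), fib m ∧ IsPullback m t' t n := by
    have := hasPullback t n hn
    exact ⟨_, _, _, fib_pullback_fst t n hn, IsPullback.of_hasPullback t n⟩
  -- Anodyne morphisms pull back along fibrations by axiom, so only the factor `t` needs an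
  -- argument. Its section `s` is again an equivalence and factors as an anodyne `k` followed by an
  -- `r` with a section. After pulling back, `k'` is anodyne and `k' ≫ r' ≫ t'` is the identity, so
  -- `r' ≫ t'` is an equivalence. Since `r'` has a section, `of_sections` gives that `t'` is one.
  obtain ⟨M, i, t, s, hi, -, rfl, hs, ht⟩ := exists_factorization hw
  obtain ⟨M', m, t', hm, sqt⟩ := pb (t := t) g hg
  have hs' : IsHomotopyEquiv s := ht.of_comp_right (by rw [hs]; exact of_isIso _)
  obtain ⟨s', hs2, sqs⟩ := key t s hs sqt
  obtain ⟨L, k, r, n, hk, -, rfl, hn, -⟩ := exists_factorization hs'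
  obtain ⟨L', l, r', hl, sqr⟩ := pb (t := r) m hm
  obtain ⟨n', hn', -⟩ := key r n hn sqr
  let k' := sqr.lift (g ≫ k) s' (by rw [Category.assoc, sqs.w])
  have hk2 : k' ≫ r' = s' := sqr.lift_snd _ _ _
  have sqk : IsPullback g k' k l :=
    IsPullback.of_bot (by rwa [hk2]) (sqr.lift_fst _ _ _).symm sqr
  have hk' : IsHomotopyEquiv k' :=
    isHomotopyEquiv_of_anodyne (anodyne_of_isPullback sqk.flip hl hk)
  have hrt : IsHomotopyEquiv (r' ≫ t') :=
    hk'.of_comp_left (by rw [← Category.assoc, hk2, hs2]; exact of_isIso _)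
  have ht' : IsHomotopyEquiv t' := of_sections hn' hrt
  let i' := sqt.lift (a ≫ i) w' (by rw [Category.assoc, sq.w])
  have hi2 : i' ≫ t' = w' := sqt.lift_snd _ _ _
  have sqi : IsPullback a i' i m :=
    IsPullback.of_bot (by rwa [hi2]) (sqt.lift_fst _ _ _).symm sqt
  rw [← hi2]
  exact (isHomotopyEquiv_of_anodyne (anodyne_of_isPullback sqi.flip hm hi)).comp ht'

/-- A homotopy equivalence between fibrations over `W` pulls back to a homotopy equivalence along
any morphism. -/
lemma IsHomotopyEquiv.of_isPullback_of_fib {K L W Z K' L' : C} {k : K ⟶ W} {l : L ⟶ W}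
    {w : K ⟶ L} {z : Z ⟶ W} {a : K' ⟶ K} {k' : K' ⟶ Z} {b : L' ⟶ L} {l' : L' ⟶ Z} {w' : K' ⟶ L'}
    (hk : fib k) (hl : fib l) (hw : IsHomotopyEquiv w) (sqk : IsPullback a k' k z)
    (sql : IsPullback b l' l z) (hwl : w ≫ l = k) (hwl' : w' ≫ l' = k')
    (hwb : w' ≫ b = a ≫ w) : IsHomotopyEquiv w' := by
  -- Factor `z` as an anodyne `d.i` followed by a fibration `d.p`. Along `d.p` the previous lemma
  -- applies and gives `w₁`. The remaining comparisons `a'` and `b'` are base changes of `d.i` along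
  -- the fibrations pulled back from `k` and `l`, hence anodyne, and two-out-of-three concludes.
  obtain ⟨d⟩ := MorphismProperty.HasFactorization.nonempty_mapFactorizationData
    (W₁ := (fib (C := C)).llp) (W₂ := fib (C := C)) z
  have := hasPullback d.p k hk
  have := hasPullback d.p l hl
  have sk := (IsPullback.of_hasPullback d.p k).flip
  have sl := (IsPullback.of_hasPullback d.p l).flip
  let a' := sk.lift a (k' ≫ d.i) (by rw [sqk.w]; simp)
  let b' := sl.lift b (l' ≫ d.i) (by rw [sql.w]; simp)
  let w₁ := sl.lift (pullback.snd d.p k ≫ w) (pullback.fst d.p k)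
    (by rw [Category.assoc, hwl, sk.w])
  have hw₁ : IsHomotopyEquiv w₁ := by
    refine IsHomotopyEquiv.of_isPullback (a := pullback.snd d.p k) (w := w)
      (g := pullback.snd d.p l) (IsPullback.of_bot ?_ (sl.lift_fst _ _ _).symm sl)
      (fib_pullback_snd _ _ d.hp) hw
    rw [hwl, sl.lift_snd]
    exact sk
  have ha' : IsHomotopyEquiv a' := by
    refine isHomotopyEquiv_of_anodyne (anodyne_of_isPullback (q' := k') (i := d.i)
      (q := pullback.fst d.p k) ?_ (fib_pullback_fst _ _ hk) d.hi)
    refine IsPullback.of_right (h₁₂ := pullback.snd d.p k) (h₂₂ := d.p) (v₁₃ := k) ?_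
      (sk.lift_snd _ _ _) sk
    rw [sk.lift_fst, d.fac]
    exact sqk
  have hb' : IsHomotopyEquiv b' := by
    refine isHomotopyEquiv_of_anodyne (anodyne_of_isPullback (q' := l') (i := d.i)
      (q := pullback.fst d.p l) ?_ (fib_pullback_fst _ _ hl) d.hi)
    refine IsPullback.of_right (h₁₂ := pullback.snd d.p l) (h₂₂ := d.p) (v₁₃ := l) ?_
      (sl.lift_snd _ _ _) sl
    rw [sl.lift_fst, d.fac]
    exact sql
  have hcomm : w' ≫ b' = a' ≫ w₁ := by
    apply sl.hom_ext
    · simp [a', b', w₁, sl.lift_fst, sk.lift_fst_assoc, hwb]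
    · simp [a', b', w₁, sl.lift_snd, sk.lift_snd, reassoc_of% hwl']
  exact hb'.of_comp_right (by rw [hcomm]; exact ha'.comp hw₁)

end HomotopyTheory

/-! ### Functors preserving homotopy equivalences -/

section Functoriality

variable {C : Type u} [Category.{v} C] [Tribe C]

/-- A functor between tribes which sends anodyne morphisms to homotopy equivalences preserves
homotopy equivalences. -/
lemma IsHomotopyEquiv.map {D : Type*} [Category* D] [Tribe D] (F : C ⥤ D)
    (hF : ∀ {A B : C} (i : A ⟶ B), (fib (C := C)).llp i → IsHomotopyEquiv (F.map i))
    {A B : C} {f : A ⟶ B} (hf : IsHomotopyEquiv f) : IsHomotopyEquiv (F.map f) := by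
  have key {A B : C} {f g : A ⟶ B} (h : Homotopic f g) :
      Homotopic (F.map f) (F.map g) := by
    obtain ⟨P, k, rfl, rfl⟩ := h
    -- Both endpoint morphisms have the same composite with `P.refl`. As `F.map P.refl` is
    -- invertible up to homotopy, it can be cancelled, and the images of the two endpoints agree up
    -- to homotopy.
    have := (isHomotopyEquiv_iff _).1 (hF _ P.anodyne_refl)
    rw [F.map_comp, F.map_comp]
    refine Homotopic.comp_left _ ?_
    rw [← toHo_map_eq_iff, ← cancel_epi ((toHo D).map (F.map P.refl))]
    simp only [← CategoryTheory.Functor.map_comp, P.refl_fst, P.refl_snd]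
  obtain ⟨g, h1, h2⟩ := hf
  exact ⟨F.map g, by simpa using key h1, by simpa using key h2⟩

/-- A homotopy equivalence in the fibrant slice is a homotopy equivalence. -/
lemma IsHomotopyEquiv.left {S : C} {A B : FibrantSlice S} {u : A ⟶ B} (hu : IsHomotopyEquiv u) :
    IsHomotopyEquiv u.hom.left :=
  IsHomotopyEquiv.map (ObjectProperty.ι _ ⋙ Over.forget S)
    (fun i hi ↦ isHomotopyEquiv_of_anodyne ((slice_llp_iff i).1 hi)) hu

end Functoriality

lemma over_comp_left {C : Type u} [Category.{v} C] {S : C} {X Y Z : Over S}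
    {f : X ⟶ Y} {g : Y ⟶ Z} {k : X ⟶ Z} (h : f ≫ g = k) :
    f.left ≫ g.left = k.left :=
  congrArg (fun k ↦ k.left) h

/-! ### Homotopy invariance of internal homs in the target -/

section PostcompEquiv

variable {C : Type u} [Category.{v} C] [Tribe C]

/-- Pullback along a fibration, as a functor between the fibrant slices. -/
noncomputable def slicePullback {X Y : C} (p : X ⟶ Y) (hp : fib p) :
    FibrantSlice Y ⥤ FibrantSlice X :=
  ObjectProperty.lift _ (ObjectProperty.ι _ ⋙ pullbackFunctor p hp) (fun A ↦
    haveI : HasPullbacksAlong p := fun h ↦ hasPullback h p hp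
    fib_pullback_snd A.obj.hom p A.property)

/-- The pullback of an anodyne morphism over `Y` is its base change along the projection `B ×_Y X ⟶
B`, a fibration because `p` is one. So the pullback functor preserves anodyne morphisms, which
suffices by `IsHomotopyEquiv.map`. -/
lemma IsHomotopyEquiv.slicePullback_map {X Y : C} (p : X ⟶ Y) (hp : fib p) {A B : FibrantSlice Y}
    {u : A ⟶ B} (hu : IsHomotopyEquiv u) : IsHomotopyEquiv ((slicePullback p hp).map u) := by
  refine IsHomotopyEquiv.map _ (fun {A B} i hi ↦ isHomotopyEquiv_of_anodyne ?_) hu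
  have : HasPullbacksAlong p := fun h ↦ hasPullback h p hp
  refine (slice_llp_iff _).2 ?_
  let i' : pullback A.obj.hom p ⟶ pullback B.obj.hom p := ((Over.pullback p).map i.hom).left
  have h1 : i' ≫ pullback.fst B.obj.hom p = pullback.fst A.obj.hom p ≫ i.hom.left :=
    pullback.lift_fst _ _ _
  have h2 : i' ≫ pullback.snd B.obj.hom p = pullback.snd A.obj.hom p := pullback.lift_snd _ _ _
  have sq : IsPullback (pullback.fst A.obj.hom p) i' i.hom.left (pullback.fst B.obj.hom p) := by
    refine IsPullback.of_bot ?_ h1.symm (IsPullback.of_hasPullback _ _)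
    rw [h2, Over.w]
    exact IsPullback.of_hasPullback _ _
  exact anodyne_of_isPullback sq.flip (fib_pullback_fst _ _ hp) ((slice_llp_iff i).1 hi)

variable {S : C}

/-- The internal hom out of `A` is pullback along `A ⟶ S` followed by dependent product. This
identification brings the axiom on dependent products to bear on postcomposition. -/
lemma postcomp_eq_piMap [HasDependentProducts C] (A : FibrantSlice S) {B D : FibrantSlice S}
    (u : B ⟶ D) : postcomp A u.hom =
      (piMap A.obj.hom A.property ((slicePullback A.obj.hom A.property).map u)).hom := by
  have : HasPullbacksAlong A.obj.hom := fun h ↦ hasPullback h A.obj.hom A.property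
  apply (curryEquiv _ A D).injective
  change uncurry (curry _) = _
  rw [uncurry_curry]
  refine ((Over.mapPullbackAdj A.obj.hom).homEquiv_naturality_right_symm _ _).symm.trans ?_
  refine congrArg ((Over.mapPullbackAdj A.obj.hom).homEquiv _ _).symm ?_
  exact ((pullbackFunctor A.obj.hom A.property).partialRightAdjointHomEquiv_map
    (X := ⟨_, HasDependentProducts.isDefined A.obj.hom A.property
      ((slicePullback A.obj.hom A.property).obj B)⟩)
    (Y := ⟨_, HasDependentProducts.isDefined A.obj.hom A.property
      ((slicePullback A.obj.hom A.property).obj D)⟩)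
    (ObjectProperty.homMk ((slicePullback A.obj.hom A.property).map u).hom)).symm

/-- Postcomposition with a homotopy equivalence is a homotopy equivalence between internal homs. -/
lemma IsHomotopyEquiv.postcomp_left [IsPiTribe C] (A : FibrantSlice S) {B D : FibrantSlice S}
    {u : B ⟶ D} (hu : IsHomotopyEquiv u) : IsHomotopyEquiv (postcomp A u.hom).left := by
  rw [postcomp_eq_piMap]
  exact (IsPiTribe.isHomotopyEquiv_piMap _ _ _ (hu.slicePullback_map _ _)).left

end PostcompEquiv

/-! ### Independence of the object of equivalences from path objects -/

section PathObjectIndependence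

variable {C : Type u} [Category.{v} C] [Tribe C] {S : C}

section

variable {Z K W : FibrantSlice S} {u : Z.obj ⟶ W.obj} {d : K.obj ⟶ W.obj} (hd : fib d.left)

lemma isPullback_pbObj_left :
    IsPullback (pbFst u d hd).left (pbSnd u d hd).left u.left d.left :=
  haveI := hasPullback u.left d.left hd
  IsPullback.of_hasPullback u.left d.left

lemma pbFst_comp : pbFst u d hd ≫ u = pbSnd u d hd ≫ d := by
  ext
  exact (isPullback_pbObj_left hd).w

@[simp]
lemma pbLift_pbSnd {X : Over S} (a : X ⟶ Z.obj) (b : X ⟶ K.obj) (w : a ≫ u = b ≫ d) :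
    pbLift hd a b w ≫ pbSnd u d hd = b := by
  have := hasPullback u.left d.left hd
  ext
  exact pullback.lift_snd (f := u.left) (g := d.left) _ _ _

lemma pbObj_hom_ext {X : Over S} {m m' : X ⟶ (pbObj u d hd).obj}
    (h1 : m ≫ pbFst u d hd = m' ≫ pbFst u d hd) (h2 : m ≫ pbSnd u d hd = m' ≫ pbSnd u d hd) :
    m = m' := by
  ext
  exact (isPullback_pbObj_left hd).hom_ext (congrArg (fun k ↦ k.left) h1)
    (congrArg (fun k ↦ k.left) h2)

end

lemma slice_pathObject_refl_fst {A : FibrantSlice S} (P : PathObject A) :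
    P.refl.hom ≫ P.fst.hom = 𝟙 _ :=
  congrArg (fun k ↦ k.hom) P.refl_fst

lemma slice_pathObject_refl_snd {A : FibrantSlice S} (P : PathObject A) :
    P.refl.hom ≫ P.snd.hom = 𝟙 _ :=
  congrArg (fun k ↦ k.hom) P.refl_snd

/-- Two-out-of-three: both `P.refl` and `Q.refl` are anodyne. -/
lemma PathObject.isHomotopyEquiv_of_refl_comp {A : C} {P Q : PathObject A} {c : P.obj ⟶ Q.obj}
    (hc : P.refl ≫ c = Q.refl) : IsHomotopyEquiv c :=
  (isHomotopyEquiv_of_anodyne P.anodyne_refl).of_comp_left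
    (by rw [hc]; exact isHomotopyEquiv_of_anodyne Q.anodyne_refl)

variable [HasDependentProducts C]

lemma postcomp_comp (A : FibrantSlice S) {B D E : FibrantSlice S} (r : B.obj ⟶ D.obj)
    (s : D.obj ⟶ E.obj) : postcomp A r ≫ postcomp A s = postcomp A (r ≫ s) := by
  rw [postcomp, curry_postcomp, Category.assoc, postcomp]

lemma fib_rInvProj_left (A : FibrantSlice S) {B : FibrantSlice S} (Q : PathObject B) :
    fib (rInvProj A Q).left :=
  MorphismProperty.comp_mem (fib (C := C)) _ _ (fib_pbFst_left _ _ _)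
    (fib_tfst_left (ihom A B).obj (ihom B A))

section Projections

variable {A B : FibrantSlice S} (P : PathObject A) (Q : PathObject B)

variable (A) in
/-- The pair of a morphism and a right inverse underlying a point of `rInv A Q`. -/
noncomputable def rInvFst : (rInv A Q).obj ⟶ (prodObj (ihom A B) (ihom B A)).obj := pbFst _ _ _

variable (A) in
/-- The homotopy underlying a point of `rInv A Q`. -/
noncomputable def rInvSnd : (rInv A Q).obj ⟶ (ihom B Q.obj).obj := pbSnd _ _ _

/-- The pair of a left inverse and a morphism underlying a point of `lInv P B`. -/
noncomputable def lInvFst {A : FibrantSlice S} (P : PathObject A) (B : FibrantSlice S) :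
    (lInv P B).obj ⟶ (prodObj (ihom B A) (ihom A B)).obj :=
  pbFst _ _ _

/-- The homotopy underlying a point of `lInv P B`. -/
noncomputable def lInvSnd {A : FibrantSlice S} (P : PathObject A) (B : FibrantSlice S) :
    (lInv P B).obj ⟶ (ihom A P.obj).obj :=
  pbSnd _ _ _

noncomputable def eqFst : (eqObj P Q).obj ⟶ (rInv A Q).obj := pbFst _ _ _

noncomputable def eqSnd : (eqObj P Q).obj ⟶ (lInv P B).obj := pbSnd _ _ _

/-- The morphism from an internal hom into a path object to the square of an internal hom. -/
noncomputable def postcompEnds (A : FibrantSlice S) {B : FibrantSlice S} (Q : PathObject B) :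
    (ihom A Q.obj).obj ⟶ (prodObj (ihom A B) (ihom A B)).obj :=
  tlift (X := (ihom A B).obj) (A := ihom A B) (postcomp A Q.fst.hom) (postcomp A Q.snd.hom)

variable {P Q} {X : Over S}

noncomputable def rInvPair (a : X ⟶ (prodObj (ihom A B) (ihom B A)).obj)
    (b : X ⟶ (ihom B Q.obj).obj) (w : a ≫ rInvBase A B = b ≫ postcompEnds B Q) :
    X ⟶ (rInv A Q).obj :=
  pbLift _ a b w

noncomputable def lInvPair (a : X ⟶ (prodObj (ihom B A) (ihom A B)).obj)
    (b : X ⟶ (ihom A P.obj).obj) (w : a ≫ lInvBase A B = b ≫ postcompEnds A P) :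
    X ⟶ (lInv P B).obj :=
  pbLift _ a b w

noncomputable def eqPair (a : X ⟶ (rInv A Q).obj) (b : X ⟶ (lInv P B).obj)
    (w : a ≫ rInvProj A Q = b ≫ lInvProj P B) : X ⟶ (eqObj P Q).obj :=
  pbLift _ a b w

@[simp]
lemma rInvPair_fst (a : X ⟶ (prodObj (ihom A B) (ihom B A)).obj) (b : X ⟶ (ihom B Q.obj).obj)
    (w : a ≫ rInvBase A B = b ≫ postcompEnds B Q) : rInvPair a b w ≫ rInvFst A Q = a :=
  pbLift_pbFst _ _ _ _

@[simp]
lemma rInvPair_snd (a : X ⟶ (prodObj (ihom A B) (ihom B A)).obj) (b : X ⟶ (ihom B Q.obj).obj)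
    (w : a ≫ rInvBase A B = b ≫ postcompEnds B Q) : rInvPair a b w ≫ rInvSnd A Q = b :=
  pbLift_pbSnd _ _ _ _

@[simp]
lemma lInvPair_fst (a : X ⟶ (prodObj (ihom B A) (ihom A B)).obj) (b : X ⟶ (ihom A P.obj).obj)
    (w : a ≫ lInvBase A B = b ≫ postcompEnds A P) : lInvPair a b w ≫ lInvFst P B = a :=
  pbLift_pbFst _ _ _ _

@[simp]
lemma lInvPair_snd (a : X ⟶ (prodObj (ihom B A) (ihom A B)).obj) (b : X ⟶ (ihom A P.obj).obj)
    (w : a ≫ lInvBase A B = b ≫ postcompEnds A P) : lInvPair a b w ≫ lInvSnd P B = b :=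
  pbLift_pbSnd _ _ _ _

@[simp]
lemma eqPair_fst (a : X ⟶ (rInv A Q).obj) (b : X ⟶ (lInv P B).obj)
    (w : a ≫ rInvProj A Q = b ≫ lInvProj P B) : eqPair a b w ≫ eqFst P Q = a :=
  pbLift_pbFst _ _ _ _

@[simp]
lemma eqPair_snd (a : X ⟶ (rInv A Q).obj) (b : X ⟶ (lInv P B).obj)
    (w : a ≫ rInvProj A Q = b ≫ lInvProj P B) : eqPair a b w ≫ eqSnd P Q = b :=
  pbLift_pbSnd _ _ _ _

lemma rInv_hom_ext {m m' : X ⟶ (rInv A Q).obj} (h1 : m ≫ rInvFst A Q = m' ≫ rInvFst A Q)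
    (h2 : m ≫ rInvSnd A Q = m' ≫ rInvSnd A Q) : m = m' :=
  pbObj_hom_ext _ h1 h2

lemma lInv_hom_ext {m m' : X ⟶ (lInv P B).obj} (h1 : m ≫ lInvFst P B = m' ≫ lInvFst P B)
    (h2 : m ≫ lInvSnd P B = m' ≫ lInvSnd P B) : m = m' :=
  pbObj_hom_ext _ h1 h2

lemma eq_hom_ext {m m' : X ⟶ (eqObj P Q).obj} (h1 : m ≫ eqFst P Q = m' ≫ eqFst P Q)
    (h2 : m ≫ eqSnd P Q = m' ≫ eqSnd P Q) : m = m' :=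
  pbObj_hom_ext _ h1 h2

variable (P Q)

lemma rInv_condition : rInvFst A Q ≫ rInvBase A B = rInvSnd A Q ≫ postcompEnds B Q :=
  pbFst_comp _

lemma lInv_condition : lInvFst P B ≫ lInvBase A B = lInvSnd P B ≫ postcompEnds A P :=
  pbFst_comp _

lemma eq_condition : eqFst P Q ≫ rInvProj A Q = eqSnd P Q ≫ lInvProj P B :=
  pbFst_comp _

lemma rInvFst_tfst : rInvFst A Q ≫ tfst (ihom A B).obj (ihom B A) = rInvProj A Q := rfl

lemma lInvFst_tsnd : lInvFst P B ≫ tsnd (ihom B A).obj (ihom A B) = lInvProj P B := rfl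

lemma isPullback_rInv_left : IsPullback (rInvFst A Q).left (rInvSnd A Q).left
    (rInvBase A B).left (postcompEnds B Q).left :=
  isPullback_pbObj_left _

lemma isPullback_lInv_left : IsPullback (lInvFst P B).left (lInvSnd P B).left
    (lInvBase A B).left (postcompEnds A P).left :=
  isPullback_pbObj_left _

lemma isPullback_eq_left : IsPullback (eqFst P Q).left (eqSnd P Q).left
    (rInvProj A Q).left (lInvProj P B).left :=
  isPullback_pbObj_left _

variable {P Q}

/-- A morphism of path objects commutes with the endpoint morphisms of internal homs. -/
lemma postcomp_postcompEnds (A : FibrantSlice S) {Q Q' : PathObject B}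
    {c : Q.obj ⟶ Q'.obj} (h1 : c ≫ Q'.fst = Q.fst) (h2 : c ≫ Q'.snd = Q.snd) :
    postcomp A c.hom ≫ postcompEnds A Q' = postcompEnds A Q := by
  rw [postcompEnds, comp_tlift, postcomp_comp, postcomp_comp, postcompEnds, ← h1, ← h2]
  rfl

/-- The morphism between objects of right invertible morphisms induced by a morphism of path
objects. -/
noncomputable def rInvMap (A : FibrantSlice S) {Q Q' : PathObject B}
    {c : Q.obj ⟶ Q'.obj} (h1 : c ≫ Q'.fst = Q.fst) (h2 : c ≫ Q'.snd = Q.snd) :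
    (rInv A Q).obj ⟶ (rInv A Q').obj :=
  rInvPair (rInvFst A Q) (rInvSnd A Q ≫ postcomp B c.hom) (by
    rw [Category.assoc, postcomp_postcompEnds B h1 h2, rInv_condition])

/-- The morphism between objects of left invertible morphisms induced by a morphism of path
objects. -/
noncomputable def lInvMap (B : FibrantSlice S) {P P' : PathObject A}
    {c : P.obj ⟶ P'.obj} (h1 : c ≫ P'.fst = P.fst) (h2 : c ≫ P'.snd = P.snd) :
    (lInv P B).obj ⟶ (lInv P' B).obj :=
  lInvPair (lInvFst P B) (lInvSnd P B ≫ postcomp A c.hom) (by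
    rw [Category.assoc, postcomp_postcompEnds A h1 h2, lInv_condition])

lemma rInvMap_rInvProj {Q Q' : PathObject B} {c : Q.obj ⟶ Q'.obj} (h1 : c ≫ Q'.fst = Q.fst)
    (h2 : c ≫ Q'.snd = Q.snd) : rInvMap A h1 h2 ≫ rInvProj A Q' = rInvProj A Q := by
  rw [← rInvFst_tfst, ← Category.assoc, rInvMap, rInvPair_fst, rInvFst_tfst]

lemma lInvMap_lInvProj {P P' : PathObject A} {c : P.obj ⟶ P'.obj} (h1 : c ≫ P'.fst = P.fst)
    (h2 : c ≫ P'.snd = P.snd) : lInvMap B h1 h2 ≫ lInvProj P' B = lInvProj P B := by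
  rw [← lInvFst_tsnd, ← Category.assoc, lInvMap, lInvPair_fst, lInvFst_tsnd]

section

variable (P Q) (e : tensor X A ⟶ B.obj) (g : tensor X B ⟶ A.obj)
  (hge : tlift (tfst X A) e ≫ g = tsnd X A) (heg : tlift (tfst X B) g ≫ e = tsnd X B)

lemma rInvLift_rInvFst : rInvLift Q e g heg ≫ rInvFst A Q = tlift (curry e) (curry g) :=
  pbLift_pbFst _ _ _ _

lemma rInvLift_rInvSnd : rInvLift Q e g heg ≫ rInvSnd A Q = curry (tsnd X B ≫ Q.refl.hom) :=
  pbLift_pbSnd _ _ _ _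

lemma lInvLift_lInvFst : lInvLift P e g hge ≫ lInvFst P B = tlift (curry g) (curry e) :=
  pbLift_pbFst _ _ _ _

lemma lInvLift_lInvSnd : lInvLift P e g hge ≫ lInvSnd P B = curry (tsnd X A ≫ P.refl.hom) :=
  pbLift_pbSnd _ _ _ _

lemma eqLift_eqFst : eqLift P Q e g hge heg ≫ eqFst P Q = rInvLift Q e g heg :=
  pbLift_pbFst _ _ _ _

lemma eqLift_eqSnd : eqLift P Q e g hge heg ≫ eqSnd P Q = lInvLift P e g hge :=
  pbLift_pbSnd _ _ _ _

end

end Projections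

section

variable {C : Type u} [Category.{v} C] [Tribe C] {S : C} [IsPiTribe C] {A B : FibrantSlice S}

/-- Postcomposition with `c` is an equivalence between the two endpoint fibrations `Hom(B, Q) ⟶
Hom(B, B) × Hom(B, B)` and `Hom(B, Q') ⟶ Hom(B, B) × Hom(B, B)`. The objects of right invertible
morphisms are base changes of these along one morphism, which need not be a fibration, so
`IsHomotopyEquiv.of_isPullback_of_fib` is what is required. -/
lemma isHomotopyEquiv_rInvMap_left {Q Q' : PathObject B} {c : Q.obj ⟶ Q'.obj}
    (h1 : c ≫ Q'.fst = Q.fst) (h2 : c ≫ Q'.snd = Q.snd) (h3 : Q.refl ≫ c = Q'.refl) :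
    IsHomotopyEquiv (rInvMap A h1 h2).left :=
  IsHomotopyEquiv.of_isPullback_of_fib (fib_postcomp_pathObject B Q) (fib_postcomp_pathObject B Q')
    ((PathObject.isHomotopyEquiv_of_refl_comp h3).postcomp_left B)
    (isPullback_rInv_left Q).flip (isPullback_rInv_left Q').flip
    (over_comp_left (postcomp_postcompEnds B h1 h2))
    (over_comp_left (rInvPair_fst _ _ _)) (over_comp_left (rInvPair_snd _ _ _))

lemma isHomotopyEquiv_lInvMap_left {P P' : PathObject A} {c : P.obj ⟶ P'.obj}
    (h1 : c ≫ P'.fst = P.fst) (h2 : c ≫ P'.snd = P.snd) (h3 : P.refl ≫ c = P'.refl) :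
    IsHomotopyEquiv (lInvMap B h1 h2).left :=
  IsHomotopyEquiv.of_isPullback_of_fib (fib_postcomp_pathObject A P) (fib_postcomp_pathObject A P')
    ((PathObject.isHomotopyEquiv_of_refl_comp h3).postcomp_left A)
    (isPullback_lInv_left P).flip (isPullback_lInv_left P').flip
    (over_comp_left (postcomp_postcompEnds A h1 h2))
    (over_comp_left (lInvPair_fst _ _ _)) (over_comp_left (lInvPair_snd _ _ _))

/-- The object of equivalences and its morphisms from isomorphisms do not depend on the path
objects, up to homotopy equivalence. -/
lemma exists_isHomotopyEquiv_eqObj (P P' : PathObject A) (Q Q' : PathObject B) :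
    ∃ w : (eqObj P Q).obj ⟶ (eqObj P' Q').obj, IsHomotopyEquiv w.left ∧
      ∀ {X : Over S} (e : tensor X A ⟶ B.obj) (g : tensor X B ⟶ A.obj)
        (hge : tlift (tfst X A) e ≫ g = tsnd X A) (heg : tlift (tfst X B) g ≫ e = tsnd X B),
        eqLift P Q e g hge heg ≫ w = eqLift P' Q' e g hge heg := by
  obtain ⟨c, hc3, hc1, hc2⟩ := P.exists_comparison P'
  obtain ⟨d, hd3, hd1, hd2⟩ := Q.exists_comparison Q'
  -- One path object is replaced at a time: each step changes a single factor of the fibre product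
  -- over `Hom(A, B)`, and the fixed factor is the morphism along which the equivalence is pulled
  -- back.
  let w₁ : (eqObj P Q).obj ⟶ (eqObj P Q').obj :=
    eqPair (eqFst P Q ≫ rInvMap A hd1 hd2) (eqSnd P Q) (by
      rw [Category.assoc, rInvMap_rInvProj, eq_condition])
  let w₂ : (eqObj P Q').obj ⟶ (eqObj P' Q').obj :=
    eqPair (eqFst P Q') (eqSnd P Q' ≫ lInvMap B hc1 hc2) (by
      rw [Category.assoc, lInvMap_lInvProj, eq_condition])
  have hw₁ : IsHomotopyEquiv w₁.left :=
    IsHomotopyEquiv.of_isPullback_of_fib (fib_rInvProj_left A Q) (fib_rInvProj_left A Q')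
      (isHomotopyEquiv_rInvMap_left hd1 hd2 hd3)
      (isPullback_eq_left P Q) (isPullback_eq_left P Q')
      (over_comp_left (rInvMap_rInvProj hd1 hd2))
      (over_comp_left (eqPair_snd _ _ _)) (over_comp_left (eqPair_fst _ _ _))
  have hw₂ : IsHomotopyEquiv w₂.left :=
    IsHomotopyEquiv.of_isPullback_of_fib (fib_lInvProj_left P B) (fib_lInvProj_left P' B)
      (isHomotopyEquiv_lInvMap_left hc1 hc2 hc3)
      (isPullback_eq_left P Q').flip (isPullback_eq_left P' Q').flip
      (over_comp_left (lInvMap_lInvProj hc1 hc2))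
      (over_comp_left (eqPair_fst _ _ _)) (over_comp_left (eqPair_snd _ _ _))
  refine ⟨w₁ ≫ w₂, hw₁.comp hw₂, fun {X} e g hge heg ↦ ?_⟩
  have hc : P.refl.hom ≫ c.hom = P'.refl.hom := congrArg (fun k ↦ k.hom) hc3
  have hd : Q.refl.hom ≫ d.hom = Q'.refl.hom := congrArg (fun k ↦ k.hom) hd3
  -- The comparisons of path objects preserve `refl`, hence send constant homotopies to constant
  -- homotopies.
  have hl : lInvLift P e g hge ≫ lInvMap B hc1 hc2 = lInvLift P' e g hge := by
    refine lInv_hom_ext ?_ ?_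
    · rw [Category.assoc, lInvMap, lInvPair_fst, lInvLift_lInvFst, lInvLift_lInvFst]
    · rw [Category.assoc, lInvMap, lInvPair_snd, ← Category.assoc, lInvLift_lInvSnd,
        curry_postcomp, Category.assoc, hc, lInvLift_lInvSnd]
  have hr : rInvLift Q e g heg ≫ rInvMap A hd1 hd2 = rInvLift Q' e g heg := by
    refine rInv_hom_ext ?_ ?_
    · rw [Category.assoc, rInvMap, rInvPair_fst, rInvLift_rInvFst, rInvLift_rInvFst]
    · rw [Category.assoc, rInvMap, rInvPair_snd, ← Category.assoc, rInvLift_rInvSnd,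
        curry_postcomp, Category.assoc, hd, rInvLift_rInvSnd]
  refine eq_hom_ext ?_ ?_
  · rw [Category.assoc, Category.assoc, eqPair_fst, eqPair_fst, ← Category.assoc, eqLift_eqFst, hr,
      eqLift_eqFst]
  · rw [Category.assoc, Category.assoc, eqPair_snd, ← Category.assoc w₁, eqPair_snd,
      ← Category.assoc, eqLift_eqSnd, hl, eqLift_eqSnd]

end

end PathObjectIndependence

/-! ### The functor represented by the object of equivalences -/

section EqDatum

variable {C : Type u} [Category.{v} C] [Tribe C] {S : C}

/-- The data classified by the object of equivalences: a morphism with a right and a left homotopy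
inverse, over a varying base `X`. -/
@[ext]
structure EqDatum {A B : FibrantSlice S} (P : PathObject A) (Q : PathObject B) (X : Over S) where
  mor : tensor X A ⟶ B.obj
  rinv : tensor X B ⟶ A.obj
  linv : tensor X B ⟶ A.obj
  rhtpy : tensor X B ⟶ Q.obj.obj
  lhtpy : tensor X A ⟶ P.obj.obj
  rhtpy_fst : tlift (tfst X B) rinv ≫ mor = rhtpy ≫ Q.fst.hom
  rhtpy_snd : tsnd X B = rhtpy ≫ Q.snd.hom
  lhtpy_fst : tlift (tfst X A) mor ≫ linv = lhtpy ≫ P.fst.hom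
  lhtpy_snd : tsnd X A = lhtpy ≫ P.snd.hom

lemma tlift_comp_tfst_tsnd {W X : Over S} {A : FibrantSlice S} (m : W ⟶ tensor X A) :
    tlift (m ≫ tfst X A) (m ≫ tsnd X A) = m :=
  tensor_hom_ext (by simp) (by simp)

lemma tlift_inj {W X : Over S} {A : FibrantSlice S} {a a' : W ⟶ X} {b b' : W ⟶ A.obj} :
    tlift a b = tlift a' b' ↔ a = a' ∧ b = b' := by
  refine ⟨fun h ↦ ⟨?_, ?_⟩, fun ⟨h1, h2⟩ ↦ by rw [h1, h2]⟩
  · simpa using congrArg (· ≫ tfst X A) h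
  · simpa using congrArg (· ≫ tsnd X A) h

variable [HasDependentProducts C] {A B : FibrantSlice S} {P : PathObject A} {Q : PathObject B}
  {X : Over S}

lemma uncurry_injective {f g : X ⟶ (ihom A B).obj} (h : uncurry f = uncurry g) : f = g := by
  rw [← curry_uncurry f, h, curry_uncurry]

/-- Transposition is injective, natural in the base and compatible with composition, so the matching
condition in the pullback defining `rInv` unwinds to the two endpoint equations of a homotopy. -/
lemma rInvBase_eq_iff (x : X ⟶ (ihom A B).obj) (y : X ⟶ (ihom B A).obj)
    (z : X ⟶ (ihom B Q.obj).obj) :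
    tlift x y ≫ rInvBase A B = z ≫ postcompEnds B Q ↔
      tlift (tfst X B) (uncurry y) ≫ uncurry x = uncurry z ≫ Q.fst.hom ∧
        tsnd X B = uncurry z ≫ Q.snd.hom := by
  rw [rInvBase, postcompEnds, comp_tlift, comp_tlift, tlift_inj, comp_icomp, tlift_tfst,
    tlift_tsnd, comp_constId]
  refine and_congr ⟨fun h ↦ ?_, fun h ↦ ?_⟩ ⟨fun h ↦ ?_, fun h ↦ ?_⟩
  · rw [← uncurry_postcomp, ← h, icomp, uncurry_curry]
  · apply uncurry_injective
    rw [uncurry_postcomp, ← h, icomp, uncurry_curry]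
  · rw [← uncurry_postcomp, ← h, constId, uncurry_curry]
  · apply uncurry_injective
    rw [uncurry_postcomp, ← h, constId, uncurry_curry]

/-- `lInvBase A B` is `rInvBase B A` by definition: a left inverse of a morphism is a morphism
having it as right inverse. -/
lemma lInvBase_eq_iff (y : X ⟶ (ihom B A).obj) (x : X ⟶ (ihom A B).obj)
    (z : X ⟶ (ihom A P.obj).obj) :
    tlift y x ≫ lInvBase A B = z ≫ postcompEnds A P ↔
      tlift (tfst X A) (uncurry x) ≫ uncurry y = uncurry z ≫ P.fst.hom ∧
        tsnd X A = uncurry z ≫ P.snd.hom :=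
  rInvBase_eq_iff y x z

lemma rInv_relations (m : X ⟶ (rInv A Q).obj) :
    tlift (tfst X B) (uncurry (m ≫ rInvFst A Q ≫ tsnd (ihom A B).obj (ihom B A))) ≫
        uncurry (m ≫ rInvProj A Q) = uncurry (m ≫ rInvSnd A Q) ≫ Q.fst.hom ∧
      tsnd X B = uncurry (m ≫ rInvSnd A Q) ≫ Q.snd.hom := by
  rw [← rInvBase_eq_iff, Category.assoc, ← rInv_condition, ← Category.assoc m,
    ← Category.assoc m, ← rInvFst_tfst, ← Category.assoc m, tlift_comp_tfst_tsnd]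

lemma lInv_relations (m : X ⟶ (lInv P B).obj) :
    tlift (tfst X A) (uncurry (m ≫ lInvProj P B)) ≫
        uncurry (m ≫ lInvFst P B ≫ tfst (ihom B A).obj (ihom A B)) =
          uncurry (m ≫ lInvSnd P B) ≫ P.fst.hom ∧
      tsnd X A = uncurry (m ≫ lInvSnd P B) ≫ P.snd.hom := by
  rw [← lInvBase_eq_iff, Category.assoc, ← lInv_condition, ← Category.assoc m,
    ← Category.assoc m, ← lInvFst_tsnd, ← Category.assoc m, tlift_comp_tfst_tsnd]

/-- The data classified by a morphism to the object of equivalences. -/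
noncomputable def eqDatum (m : X ⟶ (eqObj P Q).obj) : EqDatum P Q X where
  mor := uncurry ((m ≫ eqFst P Q) ≫ rInvProj A Q)
  rinv := uncurry ((m ≫ eqFst P Q) ≫ rInvFst A Q ≫ tsnd (ihom A B).obj (ihom B A))
  linv := uncurry ((m ≫ eqSnd P Q) ≫ lInvFst P B ≫ tfst (ihom B A).obj (ihom A B))
  rhtpy := uncurry ((m ≫ eqFst P Q) ≫ rInvSnd A Q)
  lhtpy := uncurry ((m ≫ eqSnd P Q) ≫ lInvSnd P B)
  rhtpy_fst := (rInv_relations _).1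
  rhtpy_snd := (rInv_relations _).2
  lhtpy_fst := by
    rw [Category.assoc m _ (rInvProj A Q), eq_condition, ← Category.assoc m]
    exact (lInv_relations _).1
  lhtpy_snd := (lInv_relations _).2

/-- Together with surjectivity and naturality (`eqDatum_comp`) this says that `eqObj P Q` represents
`EqDatum P Q` on all of `Over S`. A datum stores the underlying morphism once, read off through
`rInv`; its agreement with the one seen through `lInv` is `eq_condition`. -/
lemma eqDatum_injective : Function.Injective (eqDatum (P := P) (Q := Q) (X := X)) := by
  intro m m' h
  have h1 := uncurry_injective (congrArg EqDatum.mor h)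
  have h2 := uncurry_injective (congrArg EqDatum.rinv h)
  have h3 := uncurry_injective (congrArg EqDatum.linv h)
  have h4 := uncurry_injective (congrArg EqDatum.rhtpy h)
  have h5 := uncurry_injective (congrArg EqDatum.lhtpy h)
  refine eq_hom_ext (rInv_hom_ext (tensor_hom_ext ?_ ?_) h4)
    (lInv_hom_ext (tensor_hom_ext ?_ ?_) h5)
  · rw [Category.assoc _ (rInvFst A Q), rInvFst_tfst, h1, Category.assoc _ (rInvFst A Q),
      rInvFst_tfst]
  · rw [Category.assoc _ (rInvFst A Q), h2, Category.assoc _ (rInvFst A Q)]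
  · rw [Category.assoc _ (lInvFst P B), h3, Category.assoc _ (lInvFst P B)]
  · rw [Category.assoc _ (lInvFst P B), lInvFst_tsnd, Category.assoc, ← eq_condition,
      ← Category.assoc, h1, Category.assoc, eq_condition, Category.assoc _ (lInvFst P B),
      lInvFst_tsnd, Category.assoc]

lemma eqDatum_surjective : Function.Surjective (eqDatum (P := P) (Q := Q) (X := X)) := by
  intro d
  let ρ : X ⟶ (rInv A Q).obj := rInvPair (tlift (curry d.mor) (curry d.rinv)) (curry d.rhtpy)
    ((rInvBase_eq_iff _ _ _).2 (by simpa using ⟨d.rhtpy_fst, d.rhtpy_snd⟩))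
  let l : X ⟶ (lInv P B).obj := lInvPair (tlift (curry d.linv) (curry d.mor)) (curry d.lhtpy)
    ((lInvBase_eq_iff _ _ _).2 (by simpa using ⟨d.lhtpy_fst, d.lhtpy_snd⟩))
  have hρ : ρ ≫ rInvProj A Q = curry d.mor := by
    rw [← rInvFst_tfst, ← Category.assoc, rInvPair_fst, tlift_tfst]
  have hl : l ≫ lInvProj P B = curry d.mor := by
    rw [← lInvFst_tsnd, ← Category.assoc, lInvPair_fst, tlift_tsnd]
  -- The two halves glue because both project to the transpose of `d.mor`.
  refine ⟨eqPair ρ l (hρ.trans hl.symm), ?_⟩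
  ext1
  · simp only [eqDatum, eqPair_fst, hρ, uncurry_curry]
  · simp only [eqDatum, eqPair_fst]
    rw [← Category.assoc, rInvPair_fst, tlift_tsnd, uncurry_curry]
  · simp only [eqDatum, eqPair_snd]
    rw [← Category.assoc, lInvPair_fst, tlift_tfst, uncurry_curry]
  · simp only [eqDatum, eqPair_fst]
    rw [rInvPair_snd, uncurry_curry]
  · simp only [eqDatum, eqPair_snd]
    rw [lInvPair_snd, uncurry_curry]

/-- Restriction of a datum along a morphism of bases. -/
noncomputable def EqDatum.restrict (d : EqDatum P Q X) {W : Over S} (u : W ⟶ X) :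
    EqDatum P Q W where
  mor := tmap u A ≫ d.mor
  rinv := tmap u B ≫ d.rinv
  linv := tmap u B ≫ d.linv
  rhtpy := tmap u B ≫ d.rhtpy
  lhtpy := tmap u A ≫ d.lhtpy
  rhtpy_fst := by
    rw [Category.assoc, ← d.rhtpy_fst, ← Category.assoc, ← Category.assoc, comp_tlift]
    congr 1
    exact tensor_hom_ext (by rw [Category.assoc, tmap_tfst, ← Category.assoc, tlift_tfst,
      tlift_tfst, tmap_tfst]) (by simp)
  rhtpy_snd := by rw [Category.assoc, ← d.rhtpy_snd, tmap_tsnd]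
  lhtpy_fst := by
    rw [Category.assoc, ← d.lhtpy_fst, ← Category.assoc, ← Category.assoc, comp_tlift]
    congr 1
    exact tensor_hom_ext (by rw [Category.assoc, tmap_tfst, ← Category.assoc, tlift_tfst,
      tlift_tfst, tmap_tfst]) (by simp)
  lhtpy_snd := by rw [Category.assoc, ← d.lhtpy_snd, tmap_tsnd]

lemma eqDatum_comp {W : Over S} (u : W ⟶ X) (m : X ⟶ (eqObj P Q).obj) :
    eqDatum (u ≫ m) = (eqDatum m).restrict u := by
  ext1 <;> simp only [eqDatum, EqDatum.restrict, ← uncurry_comp, Category.assoc]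

section

variable (P Q) (e : tensor X A ⟶ B.obj) (g : tensor X B ⟶ A.obj)
  (hge : tlift (tfst X A) e ≫ g = tsnd X A) (heg : tlift (tfst X B) g ≫ e = tsnd X B)

/-- The datum given by mutually inverse isomorphisms and constant homotopies. -/
noncomputable def EqDatum.ofIso : EqDatum P Q X where
  mor := e
  rinv := g
  linv := g
  rhtpy := tsnd X B ≫ Q.refl.hom
  lhtpy := tsnd X A ≫ P.refl.hom
  rhtpy_fst := by rw [heg, Category.assoc, slice_pathObject_refl_fst, Category.comp_id]
  rhtpy_snd := by rw [Category.assoc, slice_pathObject_refl_snd, Category.comp_id]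
  lhtpy_fst := by rw [hge, Category.assoc, slice_pathObject_refl_fst, Category.comp_id]
  lhtpy_snd := by rw [Category.assoc, slice_pathObject_refl_snd, Category.comp_id]

/-- This lets `δ` be compared with other morphisms into an object of equivalences through its
explicit data. -/
lemma eqDatum_eqLift : eqDatum (eqLift P Q e g hge heg) = EqDatum.ofIso P Q e g hge heg := by
  ext1
  · simp only [eqDatum, eqLift_eqFst, rInvLift_rInvProj, uncurry_curry, EqDatum.ofIso]
  · simp only [eqDatum, eqLift_eqFst]
    rw [← Category.assoc, rInvLift_rInvFst, tlift_tsnd, uncurry_curry, EqDatum.ofIso]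
  · simp only [eqDatum, eqLift_eqSnd]
    rw [← Category.assoc, lInvLift_lInvFst, tlift_tfst, uncurry_curry, EqDatum.ofIso]
  · simp only [eqDatum, eqLift_eqFst, rInvLift_rInvSnd, uncurry_curry, EqDatum.ofIso]
  · simp only [eqDatum, eqLift_eqSnd, lInvLift_lInvSnd, uncurry_curry, EqDatum.ofIso]

end

end EqDatum

/-! ### Base change of families of morphisms and of equivalence data -/

section BaseChange

variable {C : Type u} [Category.{v} C] {S' S : C} (r : S' ⟶ S)

/-- The square formed by a morphism `δ` over `r` is a pullback. -/
def IsCart {D' : Over S'} {D : Over S} (δ : (Over.map r).obj D' ⟶ D) : Prop :=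
  IsPullback δ.left D'.hom D.hom r

/-- Being a pullback square means that `δ` is a universal arrow from `Over.map r` to `D`. In this
form it can be checked by comparing represented functors, with no explicit limit cones. -/
lemma isCart_iff {D' : Over S'} {D : Over S} (δ : (Over.map r).obj D' ⟶ D) :
    IsCart r δ ↔ ∀ W : Over S',
      Function.Bijective (fun f : W ⟶ D' ↦ (Over.map r).map f ≫ δ) := by
  constructor
  · intro h W
    constructor
    · intro f g hfg
      ext
      exact h.hom_ext (congrArg (fun k ↦ k.left) hfg) ((Over.w f).trans (Over.w g).symm)
    · intro k
      refine ⟨Over.homMk (h.lift k.left W.hom (Over.w k)) (h.lift_snd _ _ _), ?_⟩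
      ext
      exact h.lift_fst _ _ _
  · intro h
    refine ⟨⟨Over.w δ⟩, ⟨PullbackCone.IsLimit.mk _
      (fun s ↦ ((h (Over.mk s.snd)).2 (Over.homMk s.fst s.condition)).choose.left) (fun s ↦ ?_)
      (fun s ↦ ?_) (fun s m h1 h2 ↦ ?_)⟩⟩
    · exact congrArg (fun k ↦ k.left)
        ((h (Over.mk s.snd)).2 (Over.homMk s.fst s.condition)).choose_spec
    · exact Over.w ((h (Over.mk s.snd)).2 (Over.homMk s.fst s.condition)).choose
    · let m' : Over.mk s.snd ⟶ D' := Over.homMk m h2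
      have := (h (Over.mk s.snd)).1 (a₁ := m') (Eq.trans (by
        ext
        exact h1) ((h (Over.mk s.snd)).2 (Over.homMk s.fst s.condition)).choose_spec.symm)
      exact congrArg (fun k ↦ k.left) this

variable {r}

namespace IsCart

variable {D' : Over S'} {D : Over S} {δ : (Over.map r).obj D' ⟶ D}

lemma hom_ext (h : IsCart r δ) {W : Over S'} {f g : W ⟶ D'}
    (w : (Over.map r).map f ≫ δ = (Over.map r).map g ≫ δ) : f = g :=
  ((isCart_iff r δ).1 h W).1 w

lemma exists_lift (h : IsCart r δ) {W : Over S'} (k : (Over.map r).obj W ⟶ D) :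
    ∃ f : W ⟶ D', (Over.map r).map f ≫ δ = k :=
  ((isCart_iff r δ).1 h W).2 k

end IsCart

variable [Tribe C]

/-- The comparison between products over `S'` and over `S`. -/
noncomputable def tensorComparison {A' : FibrantSlice S'} {A : FibrantSlice S}
    (α : (Over.map r).obj A'.obj ⟶ A.obj) (X : Over S') :
    (Over.map r).obj (tensor X A') ⟶ tensor ((Over.map r).obj X) A :=
  tlift ((Over.map r).map (tfst X A')) ((Over.map r).map (tsnd X A') ≫ α)

section

variable {A' : FibrantSlice S'} {A : FibrantSlice S} {α : (Over.map r).obj A'.obj ⟶ A.obj}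

lemma tensorComparison_tfst (X : Over S') : tensorComparison α X ≫ tfst _ A =
    (Over.map r).map (tfst X A') :=
  tlift_tfst _ _

lemma tensorComparison_tsnd (X : Over S') : tensorComparison α X ≫ tsnd _ A =
    (Over.map r).map (tsnd X A') ≫ α :=
  tlift_tsnd _ _

lemma isPullback_tensor_left (X : Over S) :
    IsPullback (tfst X A).left (tsnd X A).left X.hom A.obj.hom :=
  IsPullback.of_hasPullback _ _

/-- Pullback pasting: since `A'` is the base change of `A` along `r`, the fibre product of `X` with
`A'` over `S'` is also its fibre product with `A` over `S`. -/
lemma isIso_tensorComparison (hα : IsCart r α) (X : Over S') : IsIso (tensorComparison α X) := by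
  have sq : IsPullback (tfst X A').left ((tsnd X A').left ≫ α.left) (X.hom ≫ r) A.obj.hom :=
    IsPullback.paste_vert (isPullback_tensor_left X) hα.flip
  have sq' := isPullback_tensor_left (A := A) ((Over.map r).obj X)
  have h : (tensorComparison α X).left = (sq.isoIsPullback _ _ sq').hom := by
    apply sq'.hom_ext
    · exact (over_comp_left (tensorComparison_tfst X)).trans
        (sq.isoIsPullback_hom_fst _ _ sq').symm
    · exact (over_comp_left (tensorComparison_tsnd X)).trans
        (sq.isoIsPullback_hom_snd _ _ sq').symm
  have : IsIso ((Over.forget S).map (tensorComparison α X)) := by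
    change IsIso (tensorComparison α X).left
    rw [h]
    infer_instance
  exact isIso_of_reflects_iso _ (Over.forget S)

lemma tensorComparison_tmap {X W : Over S'} (u : W ⟶ X) :
    (Over.map r).map (tmap u A') ≫ tensorComparison α X =
      tensorComparison α W ≫ tmap ((Over.map r).map u) A := by
  apply tensor_hom_ext
  · rw [Category.assoc, tensorComparison_tfst, Category.assoc, tmap_tfst, ← Functor.map_comp,
      tmap_tfst, ← Category.assoc, tensorComparison_tfst, Functor.map_comp]
  · rw [Category.assoc, tensorComparison_tsnd, Category.assoc, tmap_tsnd, ← Category.assoc,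
      ← Functor.map_comp, tmap_tsnd, tensorComparison_tsnd]

variable {D' : Over S'} {D : Over S}

/-- The base change along `r` of a family of morphisms parametrised by `X`. -/
noncomputable def transpose (hα : IsCart r α) {X : Over S'} (δ : (Over.map r).obj D' ⟶ D)
    (f : tensor X A' ⟶ D') : tensor ((Over.map r).obj X) A ⟶ D :=
  haveI := isIso_tensorComparison hα X
  inv (tensorComparison α X) ≫ (Over.map r).map f ≫ δ

variable (hα : IsCart r α) {X : Over S'} {δ : (Over.map r).obj D' ⟶ D}

lemma tensorComparison_transpose (f : tensor X A' ⟶ D') :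
    tensorComparison α X ≫ transpose hα δ f = (Over.map r).map f ≫ δ := by
  have := isIso_tensorComparison hα X
  rw [transpose, IsIso.hom_inv_id_assoc]

lemma transpose_eq_iff (f : tensor X A' ⟶ D') (k : tensor ((Over.map r).obj X) A ⟶ D) :
    transpose hα δ f = k ↔ (Over.map r).map f ≫ δ = tensorComparison α X ≫ k := by
  have := isIso_tensorComparison hα X
  rw [← cancel_epi (tensorComparison α X), tensorComparison_transpose]

/-- With `exists_transpose_eq`, families over `S'` with values in `D'` are the same as families over
`S`, with parameters restricted along `r`, and with values in `D`. This is the stability of internal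
homs under base change, stated on generalised elements. -/
lemma transpose_injective (hδ : IsCart r δ) {f g : tensor X A' ⟶ D'}
    (h : transpose hα δ f = transpose hα δ g) : f = g := by
  rw [transpose_eq_iff, tensorComparison_transpose] at h
  exact hδ.hom_ext h

lemma exists_transpose_eq (hδ : IsCart r δ) (k : tensor ((Over.map r).obj X) A ⟶ D) :
    ∃ f : tensor X A' ⟶ D', transpose hα δ f = k := by
  obtain ⟨f, hf⟩ := hδ.exists_lift (tensorComparison α X ≫ k)
  exact ⟨f, (transpose_eq_iff hα f k).2 hf⟩

lemma transpose_tsnd : transpose hα α (tsnd X A') = tsnd _ A := by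
  rw [transpose_eq_iff, tensorComparison_tsnd]

lemma transpose_tmap {W : Over S'} (u : W ⟶ X) (f : tensor X A' ⟶ D') :
    transpose hα δ (tmap u A' ≫ f) = tmap ((Over.map r).map u) A ≫ transpose hα δ f := by
  rw [transpose_eq_iff, ← Category.assoc, ← tensorComparison_tmap, Category.assoc,
    tensorComparison_transpose, Functor.map_comp, Category.assoc]

lemma transpose_comp {E' : Over S'} {E : Over S} {ε : (Over.map r).obj E' ⟶ E} {u' : D' ⟶ E'}
    {u : D ⟶ E} (h : (Over.map r).map u' ≫ ε = δ ≫ u) (f : tensor X A' ⟶ D') :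
    transpose hα ε (f ≫ u') = transpose hα δ f ≫ u := by
  rw [transpose_eq_iff, ← Category.assoc, tensorComparison_transpose, Category.assoc, ← h,
    Functor.map_comp, Category.assoc]

/-- Base change is compatible with composition of families over a fixed parameter object, the
operation occurring in the inverse equations of `EqDatum`. -/
lemma transpose_tlift_comp {B' : FibrantSlice S'} {B : FibrantSlice S}
    {β : (Over.map r).obj B'.obj ⟶ B.obj} (hβ : IsCart r β) (g : tensor X B' ⟶ A'.obj)
    (f : tensor X A' ⟶ D') :
    transpose hβ δ (tlift (tfst X B') g ≫ f) =
      tlift (tfst _ B) (transpose hβ α g) ≫ transpose hα δ f := by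
  rw [transpose_eq_iff, ← Category.assoc]
  have h : tensorComparison β X ≫ tlift (tfst _ B) (transpose hβ α g) =
      (Over.map r).map (tlift (tfst X B') g) ≫ tensorComparison α X := by
    apply tensor_hom_ext
    · rw [Category.assoc, tlift_tfst, Category.assoc, tensorComparison_tfst,
        tensorComparison_tfst, ← Functor.map_comp, tlift_tfst]
    · rw [Category.assoc, tlift_tsnd, Category.assoc, tensorComparison_tsnd,
        tensorComparison_transpose, ← Category.assoc, ← Functor.map_comp, tlift_tsnd]
  rw [h, Category.assoc, tensorComparison_transpose, Functor.map_comp, Category.assoc]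

end

/-- A path object over `S'` which is the base change along `r` of a path object over `S`. -/
structure PathObject.IsBaseChange {A' : FibrantSlice S'} {A : FibrantSlice S}
    (α : (Over.map r).obj A'.obj ⟶ A.obj) (P' : PathObject A') (P : PathObject A)
    (π : (Over.map r).obj P'.obj.obj ⟶ P.obj.obj) : Prop where
  isCart : IsCart r π
  refl : (Over.map r).map P'.refl.hom ≫ π = α ≫ P.refl.hom
  fst : (Over.map r).map P'.fst.hom ≫ α = π ≫ P.fst.hom
  snd : (Over.map r).map P'.snd.hom ≫ α = π ≫ P.snd.hom

variable {A' B' : FibrantSlice S'} {A B : FibrantSlice S}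
  {α : (Over.map r).obj A'.obj ⟶ A.obj} {β : (Over.map r).obj B'.obj ⟶ B.obj}
  (hα : IsCart r α) (hβ : IsCart r β) {P' : PathObject A'} {P : PathObject A}
  {Q' : PathObject B'} {Q : PathObject B} {π : (Over.map r).obj P'.obj.obj ⟶ P.obj.obj}
  {θ : (Over.map r).obj Q'.obj.obj ⟶ Q.obj.obj} (hP : P'.IsBaseChange α P π)
  (hQ : Q'.IsBaseChange β Q θ)

/-- Base change of equivalence data. -/
noncomputable def EqDatum.baseChange {X : Over S'} (d : EqDatum P' Q' X) :
    EqDatum P Q ((Over.map r).obj X) where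
  mor := transpose hα β d.mor
  rinv := transpose hβ α d.rinv
  linv := transpose hβ α d.linv
  rhtpy := transpose hβ θ d.rhtpy
  lhtpy := transpose hα π d.lhtpy
  rhtpy_fst := by
    rw [← transpose_tlift_comp, d.rhtpy_fst, transpose_comp hβ hQ.fst]
  rhtpy_snd := by
    rw [← transpose_comp hβ hQ.snd, ← d.rhtpy_snd, transpose_tsnd]
  lhtpy_fst := by
    rw [← transpose_tlift_comp, d.lhtpy_fst, transpose_comp hα hP.fst]
  lhtpy_snd := by
    rw [← transpose_comp hα hP.snd, ← d.lhtpy_snd, transpose_tsnd]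

lemma EqDatum.baseChange_injective {X : Over S'} {d d' : EqDatum P' Q' X}
    (h : d.baseChange hα hβ hP hQ = d'.baseChange hα hβ hP hQ) : d = d' := by
  ext1
  · exact transpose_injective hα hβ (congrArg EqDatum.mor h)
  · exact transpose_injective hβ hα (congrArg EqDatum.rinv h)
  · exact transpose_injective hβ hα (congrArg EqDatum.linv h)
  · exact transpose_injective hβ hQ.isCart (congrArg EqDatum.rhtpy h)
  · exact transpose_injective hα hP.isCart (congrArg EqDatum.lhtpy h)

/-- Each of the five components is a transpose because its target is cartesian over `r`. Both sides
of every required equation then become transposes, so the equations descend to `S'` by injectivity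
of transposition. -/
lemma EqDatum.exists_baseChange_eq {X : Over S'} (d : EqDatum P Q ((Over.map r).obj X)) :
    ∃ d' : EqDatum P' Q' X, d'.baseChange hα hβ hP hQ = d := by
  obtain ⟨mor, rinv, linv, rhtpy, lhtpy, h1, h2, h3, h4⟩ := d
  obtain ⟨mor, rfl⟩ := exists_transpose_eq hα hβ mor
  obtain ⟨rinv, rfl⟩ := exists_transpose_eq hβ hα rinv
  obtain ⟨linv, rfl⟩ := exists_transpose_eq hβ hα linv
  obtain ⟨rhtpy, rfl⟩ := exists_transpose_eq hβ hQ.isCart rhtpy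
  obtain ⟨lhtpy, rfl⟩ := exists_transpose_eq hα hP.isCart lhtpy
  rw [← transpose_tlift_comp, ← transpose_comp hβ hQ.fst] at h1
  rw [← transpose_comp hβ hQ.snd, ← transpose_tsnd hβ] at h2
  rw [← transpose_tlift_comp, ← transpose_comp hα hP.fst] at h3
  rw [← transpose_comp hα hP.snd, ← transpose_tsnd hα] at h4
  exact ⟨⟨mor, rinv, linv, rhtpy, lhtpy, transpose_injective hβ hβ h1,
    transpose_injective hβ hβ h2, transpose_injective hα hα h3, transpose_injective hα hα h4⟩, rfl⟩

lemma EqDatum.baseChange_restrict {X W : Over S'} (d : EqDatum P' Q' X) (u : W ⟶ X) :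
    (d.restrict u).baseChange hα hβ hP hQ =
      (d.baseChange hα hβ hP hQ).restrict ((Over.map r).map u) := by
  ext1
  · exact transpose_tmap hα _ _
  · exact transpose_tmap hβ _ _
  · exact transpose_tmap hβ _ _
  · exact transpose_tmap hβ _ _
  · exact transpose_tmap hα _ _

/-- The object of equivalences is stable under base change. -/
lemma exists_isCart_eqObj [HasDependentProducts C] :
    ∃ γ : (Over.map r).obj (eqObj P' Q').obj ⟶ (eqObj P Q).obj, IsCart r γ ∧
      ∀ {X : Over S'} (m : X ⟶ (eqObj P' Q').obj),
        eqDatum ((Over.map r).map m ≫ γ) = (eqDatum m).baseChange hα hβ hP hQ := by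
  -- Yoneda: `γ` classifies the base change of the universal datum over `S'`. By naturality,
  -- composing with `γ` then realises base change of data over every parameter object, and
  -- bijectivity of that operation says that `γ` is cartesian.
  obtain ⟨γ, hγ⟩ := eqDatum_surjective ((eqDatum (𝟙 (eqObj P' Q').obj)).baseChange hα hβ hP hQ)
  have key {X : Over S'} (m : X ⟶ (eqObj P' Q').obj) :
      eqDatum ((Over.map r).map m ≫ γ) = (eqDatum m).baseChange hα hβ hP hQ := by
    rw [eqDatum_comp, hγ, ← EqDatum.baseChange_restrict, ← eqDatum_comp, Category.comp_id]
  refine ⟨γ, (isCart_iff r γ).2 fun W ↦ ⟨fun m m' h ↦ ?_, fun k ↦ ?_⟩, key⟩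
  · apply eqDatum_injective
    apply EqDatum.baseChange_injective hα hβ hP hQ
    rw [← key, ← key]
    exact congrArg eqDatum h
  · obtain ⟨d, hd⟩ := EqDatum.exists_baseChange_eq hα hβ hP hQ (eqDatum k)
    obtain ⟨m, rfl⟩ := eqDatum_surjective d
    exact ⟨m, eqDatum_injective ((key m).trans hd)⟩

end BaseChange

/-! ### Base change of path objects -/

section BaseChangePathObject

variable {C : Type u} [Category.{v} C] {S' S : C} {r : S' ⟶ S}

/-- By pullback cancellation, a morphism over `S'` lying above one over `S` is its base change along
the cartesian comparison of the codomains. Anodyne morphisms and fibrations can thus be transferred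
from `S` to `S'`. -/
lemma IsCart.isPullback_left {D' E' : Over S'} {D E : Over S} {δ : (Over.map r).obj D' ⟶ D}
    {ε : (Over.map r).obj E' ⟶ E} (hδ : IsCart r δ) (hε : IsCart r ε) {u' : D' ⟶ E'} {u : D ⟶ E}
    (h : (Over.map r).map u' ≫ ε = δ ≫ u) : IsPullback δ.left u'.left u.left ε.left := by
  refine IsPullback.of_bot ?_ (congrArg (fun k ↦ k.left) h).symm hε
  rw [Over.w, Over.w]
  exact hδ

variable [Tribe C]

lemma IsCart.fib_left (hr : fib r) {D' : Over S'} {D : Over S} {δ : (Over.map r).obj D' ⟶ D}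
    (hδ : IsCart r δ) : fib δ.left :=
  MorphismProperty.of_isPullback (IsPullback.flip hδ) hr

/-- The comparison of squares over `S'` and over `S`. -/
lemma isCart_square {A' : FibrantSlice S'} {A : FibrantSlice S}
    {α : (Over.map r).obj A'.obj ⟶ A.obj} (hα : IsCart r α) :
    IsCart r (tlift ((Over.map r).map (tfst A'.obj A') ≫ α)
      ((Over.map r).map (tsnd A'.obj A') ≫ α)) := by
  rw [isCart_iff]
  intro W
  constructor
  · intro f g h
    simp only [comp_tlift, tlift_inj, ← Category.assoc, ← Functor.map_comp] at h
    exact tensor_hom_ext (hα.hom_ext h.1) (hα.hom_ext h.2)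
  · intro k
    obtain ⟨a, ha⟩ := hα.exists_lift (k ≫ tfst A.obj A)
    obtain ⟨b, hb⟩ := hα.exists_lift (k ≫ tsnd A.obj A)
    refine ⟨tlift a b, ?_⟩
    simp only [comp_tlift]
    rw [← Category.assoc, ← Functor.map_comp, tlift_tfst, ← Category.assoc, ← Functor.map_comp,
      tlift_tsnd, ha, hb, tlift_comp_tfst_tsnd]

/-- The fibration criterion for a morphism to a product in the fibrant slice. -/
lemma fib_prod_lift_of_tlift {S : C} {B W : FibrantSlice S} (f g : W ⟶ B)
    (h : fib (tlift (X := B.obj) (A := B) f.hom g.hom).left) : fib (prod.lift f g) := by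
  -- `c` is the isomorphism from the fibre product over `S` to the chosen categorical product of the
  -- slice; composing with it does not affect being a fibration.
  let c : prodObj B B ⟶ B ⨯ B :=
    prod.lift (ObjectProperty.homMk (tfst B.obj B)) (ObjectProperty.homMk (tsnd B.obj B))
  let c' : B ⨯ B ⟶ prodObj B B := ObjectProperty.homMk
    (tlift (X := B.obj) (A := B) (prod.fst (X := B) (Y := B)).hom (prod.snd (X := B) (Y := B)).hom)
  have hfst {W : FibrantSlice S} (m : W ⟶ prodObj B B) :
      m ≫ c ≫ prod.fst = ObjectProperty.homMk (m.hom ≫ tfst B.obj B) := by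
    simp only [c, prod.lift_fst]
    rfl
  have hsnd {W : FibrantSlice S} (m : W ⟶ prodObj B B) :
      m ≫ c ≫ prod.snd = ObjectProperty.homMk (m.hom ≫ tsnd B.obj B) := by
    simp only [c, prod.lift_snd]
    rfl
  have hcomp {W : FibrantSlice S} (a b : W ⟶ B) : (ObjectProperty.homMk
      (tlift (X := B.obj) (A := B) a.hom b.hom) : W ⟶ prodObj B B) ≫ c = prod.lift a b := by
    apply Limits.prod.hom_ext
    · rw [Category.assoc, hfst, prod.lift_fst]
      ext1
      exact tlift_tfst _ _
    · rw [Category.assoc, hsnd, prod.lift_snd]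
      ext1
      exact tlift_tsnd _ _
  have hcc' : c ≫ c' = 𝟙 _ := by
    ext1
    refine tensor_hom_ext ?_ ?_
    · have := congrArg (fun k ↦ k.hom) (hfst (𝟙 _))
      simp only [Category.id_comp] at this
      exact (Category.assoc _ _ _).trans ((congrArg (c.hom ≫ ·) (tlift_tfst _ _)).trans this)
    · have := congrArg (fun k ↦ k.hom) (hsnd (𝟙 _))
      simp only [Category.id_comp] at this
      exact (Category.assoc _ _ _).trans ((congrArg (c.hom ≫ ·) (tlift_tsnd _ _)).trans this)
  have hc'c : c' ≫ c = 𝟙 _ := by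
    rw [hcomp, prod.lift_fst_snd]
  have : IsIso c := ⟨c', hcc', hc'c⟩
  rw [← hcomp]
  exact fib_comp (C := FibrantSlice S) h (fib_of_isIso c)

/-- Path objects can be pulled back along fibrations. -/
lemma exists_isBaseChange (hr : fib r) {A' : FibrantSlice S'} {A : FibrantSlice S}
    {α : (Over.map r).obj A'.obj ⟶ A.obj} (hα : IsCart r α) (P : PathObject A) :
    ∃ (P' : PathObject A') (π : (Over.map r).obj P'.obj.obj ⟶ P.obj.obj),
      P'.IsBaseChange α P π := by
  have := hasPullback P.obj.obj.hom r hr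
  let D : FibrantSlice S' :=
    FibrantSlice.mk (pullback.snd P.obj.obj.hom r) (fib_pullback_snd _ _ P.obj.property)
  let π : (Over.map r).obj D.obj ⟶ P.obj.obj :=
    Over.homMk (pullback.fst P.obj.obj.hom r) pullback.condition
  have hπ : IsCart r π := IsPullback.of_hasPullback _ _
  -- The structure maps are the unique ones over `S'` lying above those of `P`; the required
  -- identities hold after mapping down to `S`.
  obtain ⟨i, hi⟩ := hπ.exists_lift (α ≫ P.refl.hom)
  obtain ⟨a, ha⟩ := hα.exists_lift (π ≫ P.fst.hom)
  obtain ⟨b, hb⟩ := hα.exists_lift (π ≫ P.snd.hom)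
  have hia : i ≫ a = 𝟙 _ := by
    apply hα.hom_ext
    rw [Functor.map_comp, Category.assoc, ha, ← Category.assoc, hi, Category.assoc,
      slice_pathObject_refl_fst, CategoryTheory.Functor.map_id, Category.id_comp, Category.comp_id]
  have hib : i ≫ b = 𝟙 _ := by
    apply hα.hom_ext
    rw [Functor.map_comp, Category.assoc, hb, ← Category.assoc, hi, Category.assoc,
      slice_pathObject_refl_snd, CategoryTheory.Functor.map_id, Category.id_comp, Category.comp_id]
  have hab : (Over.map r).map (tlift (X := A'.obj) (A := A') a b) ≫
      tlift (X := A.obj) (A := A) ((Over.map r).map (tfst A'.obj A') ≫ α)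
        ((Over.map r).map (tsnd A'.obj A') ≫ α) =
      π ≫ tlift (X := A.obj) (A := A) P.fst.hom P.snd.hom := by
    rw [comp_tlift, comp_tlift, ← Category.assoc, ← Category.assoc, ← Functor.map_comp,
      ← Functor.map_comp, tlift_tfst, tlift_tsnd, ha, hb]
  let P' : PathObject A' :=
    { obj := D
      refl := ObjectProperty.homMk i
      fst := ObjectProperty.homMk a
      snd := ObjectProperty.homMk b
      refl_fst := ObjectProperty.hom_ext _ hia
      refl_snd := ObjectProperty.hom_ext _ hib
      -- The new `refl` is the base change of `P.refl` along `π`. Here `r` has to be a fibration,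
      -- since `π` is a base change of `r` and anodyne morphisms are pulled back only along
      -- fibrations.
      anodyne_refl := (slice_llp_iff _).2 (anodyne_of_isPullback
        (IsCart.isPullback_left hα hπ hi).flip (hπ.fib_left hr)
        ((slice_llp_iff _).1 P.anodyne_refl))
      -- The endpoint morphism is the base change of that of `P` along the comparison of the
      -- fibrewise squares of `A'` and `A`.
      fib_lift := fib_prod_lift_of_tlift _ _ (MorphismProperty.of_isPullback
        (IsCart.isPullback_left hπ (isCart_square hα) hab) (fib_pathObject_tlift P)) }
  exact ⟨P', π, hπ, hi, ha, hb⟩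

end BaseChangePathObject

/-! ### Univalence under pullback, and the diagonal of `f` -/

section Univalence

variable {C : Type u} [Category.{v} C] [Tribe C]

/-- Changing one factor at a time, `f × 1` is a base change of `f` and `1 × g` is a base change of
`g`. -/
lemma fib_prod_map {A B A' B' : C} {f : A ⟶ A'} {g : B ⟶ B'} (hf : fib f) (hg : fib g) :
    fib (prod.map f g) := by
  have h1 : IsPullback (prod.fst : A ⨯ B ⟶ A) (prod.map f (𝟙 B)) f prod.fst := by
    refine ⟨⟨(prod.map_fst _ _).symm⟩, ⟨PullbackCone.IsLimit.mk _
      (fun s ↦ prod.lift s.fst (s.snd ≫ prod.snd)) (fun s ↦ prod.lift_fst _ _) (fun s ↦ ?_)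
      (fun s m h1 h2 ↦ ?_)⟩⟩
    · apply Limits.prod.hom_ext
      · rw [Category.assoc, prod.map_fst, prod.lift_fst_assoc, s.condition]
      · rw [Category.assoc, prod.map_snd, prod.lift_snd_assoc, Category.comp_id]
    · apply Limits.prod.hom_ext
      · rw [prod.lift_fst, h1]
      · rw [prod.lift_snd, ← h2, Category.assoc, prod.map_snd, Category.comp_id]
  have h2 : IsPullback (prod.snd : A' ⨯ B ⟶ B) (prod.map (𝟙 A') g) g prod.snd := by
    refine ⟨⟨(prod.map_snd _ _).symm⟩, ⟨PullbackCone.IsLimit.mk _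
      (fun s ↦ prod.lift (s.snd ≫ prod.fst) s.fst) (fun s ↦ prod.lift_snd _ _) (fun s ↦ ?_)
      (fun s m h1 h2 ↦ ?_)⟩⟩
    · apply Limits.prod.hom_ext
      · rw [Category.assoc, prod.map_fst, prod.lift_fst_assoc, Category.comp_id]
      · rw [Category.assoc, prod.map_snd, prod.lift_snd_assoc, s.condition]
    · apply Limits.prod.hom_ext
      · rw [prod.lift_fst, ← h2, Category.assoc, prod.map_fst, Category.comp_id]
      · rw [prod.lift_snd, h1]
  have h : prod.map f g = prod.map f (𝟙 B) ≫ prod.map (𝟙 A') g := by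
    rw [prod.map_map, Category.comp_id, Category.id_comp]
  rw [h]
  exact fib_comp (MorphismProperty.of_isPullback h1 hf) (MorphismProperty.of_isPullback h2 hg)

section

variable {X E Y B : C} {h : X ⟶ E} {q : X ⟶ Y} {p : E ⟶ B} {f : Y ⟶ B} (hp : fib p) (hq : fib q)

lemma isPullback_baseChange {S : C} (s : S ⟶ B) :
    IsPullback (baseChangeProj s p hp) (baseChange s p hp).obj.hom p s :=
  haveI := hasPullback s p hp
  (IsPullback.of_hasPullback s p).flip

lemma baseChange_hom_ext {S : C} (s : S ⟶ B) {W : Over S} {a b : W ⟶ (baseChange s p hp).obj}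
    (w : a.left ≫ baseChangeProj s p hp = b.left ≫ baseChangeProj s p hp) : a = b := by
  ext
  exact (isPullback_baseChange hp s).hom_ext w ((Over.w a).trans (Over.w b).symm)

/-- The comparison of base changes of `q` and of `p`, where `q` is a pullback of `p`. -/
lemma exists_isCart_baseChange (sq : IsPullback h q p f) {S' S : C} {r : S' ⟶ S}
    {s' : S' ⟶ Y} {s : S ⟶ B} (w : r ≫ s = s' ≫ f) :
    ∃ α : (Over.map r).obj (baseChange s' q hq).obj ⟶ (baseChange s p hp).obj, IsCart r α ∧
      α.left ≫ baseChangeProj s p hp = baseChangeProj s' q hq ≫ h := by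
  have sq' := isPullback_baseChange hp s
  have sq'' : IsPullback (baseChangeProj s' q hq ≫ h) (baseChange s' q hq).obj.hom p (r ≫ s) := by
    rw [w]
    exact (isPullback_baseChange hq s').paste_horiz sq
  let a := sq'.lift (baseChangeProj s' q hq ≫ h) ((baseChange s' q hq).obj.hom ≫ r)
    (by rw [sq''.w, Category.assoc])
  have ha : a ≫ baseChangeProj s p hp = baseChangeProj s' q hq ≫ h := sq'.lift_fst _ _ _
  have ha' : a ≫ (baseChange s p hp).obj.hom = (baseChange s' q hq).obj.hom ≫ r :=
    sq'.lift_snd _ _ _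
  exact ⟨Over.homMk a ha', IsPullback.of_right (by rwa [← ha] at sq'') ha' sq', ha⟩

/-- Transport along an identity is compatible with base change. -/
lemma transpose_idTransport {S' S : C} {r : S' ⟶ S} {s₁' s₂' : S' ⟶ Y} {s₁ s₂ : S ⟶ B}
    {α : (Over.map r).obj (baseChange s₁' q hq).obj ⟶ (baseChange s₁ p hp).obj}
    {β : (Over.map r).obj (baseChange s₂' q hq).obj ⟶ (baseChange s₂ p hp).obj}
    (hα : IsCart r α)
    (hα' : α.left ≫ baseChangeProj s₁ p hp = baseChangeProj s₁' q hq ≫ h)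
    (hβ' : β.left ≫ baseChangeProj s₂ p hp = baseChangeProj s₂' q hq ≫ h)
    {W' : Over S'} {W : Over S} (u : (Over.map r).obj W' ⟶ W)
    (hW' : W'.hom ≫ s₁' = W'.hom ≫ s₂') (hW : W.hom ≫ s₁ = W.hom ≫ s₂) :
    transpose hα β (idTransport s₁' s₂' q hq W' hW') =
      tmap u (baseChange s₁ p hp) ≫ idTransport s₁ s₂ p hp W hW := by
  rw [transpose_eq_iff]
  -- Transport along an identity does not change the projection to the total space, so both sides
  -- agree after projecting to `E`.
  apply baseChange_hom_ext
  have h1 : (tensorComparison α W' ≫ tmap u _).left ≫ (tsnd W (baseChange s₁ p hp)).left =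
      (tsnd W' (baseChange s₁' q hq)).left ≫ α.left := by
    refine (over_comp_left (k := (Over.map r).map (tsnd W' (baseChange s₁' q hq)) ≫ α) ?_).trans rfl
    rw [Category.assoc, tmap_tsnd, tensorComparison_tsnd]
  have h2 : ((Over.map r).map (idTransport s₁' s₂' q hq W' hW') ≫ β).left =
      (idTransport s₁' s₂' q hq W' hW').left ≫ β.left := rfl
  have h3 : (tensorComparison α W' ≫ tmap u (baseChange s₁ p hp) ≫
      idTransport s₁ s₂ p hp W hW).left =
      (tensorComparison α W' ≫ tmap u _).left ≫ (idTransport s₁ s₂ p hp W hW).left :=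
    (over_comp_left (Category.assoc _ _ _)).symm
  rw [h2, h3, Category.assoc, hβ', ← Category.assoc, idTransport_proj, Category.assoc,
    Category.assoc, idTransport_proj]
  have h4 := h1 =≫ baseChangeProj s₁ p hp
  rw [Category.assoc, Category.assoc, hα'] at h4
  exact h4.symm

end

/-- A fibration is a homotopy monomorphism if and only if its diagonal is a homotopy equivalence. -/
lemma isHomotopyMono_iff {Y B : C} {f : Y ⟶ B} (hf : fib f) [HasPullback f f] :
    IsHomotopyMono f ↔ IsHomotopyEquiv (pullback.diagonal f) := by
  have key (d : MorphismProperty.MapFactorizationData (fib (C := C)).llp fib f)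
      [HasPullback f d.p] (w : 𝟙 Y ≫ f = (𝟙 Y ≫ d.i) ≫ d.p) :
      IsHomotopyEquiv (pullback.lift (f := f) (g := d.p) (𝟙 Y) (𝟙 Y ≫ d.i) w) ↔
        IsHomotopyEquiv (pullback.diagonal f) := by
    -- The strict and the homotopy fibre product differ by `j`, a base change of `d.i` along a
    -- fibration since `f` is one. The comparison map of the homotopy pullback is the diagonal
    -- followed by `j`.
    let j : pullback f f ⟶ pullback f d.p := pullback.lift (pullback.fst f f)
      (pullback.snd f f ≫ d.i) (by rw [Category.assoc, d.fac, pullback.condition])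
    have hj : IsHomotopyEquiv j := by
      refine isHomotopyEquiv_of_anodyne (anodyne_of_isPullback (q := pullback.snd f d.p)
        (i := d.i) (q' := pullback.snd f f) ?_ (fib_pullback_snd _ _ hf) d.hi)
      refine IsPullback.of_right (h₁₂ := pullback.fst f d.p) (h₂₂ := d.p) (v₁₃ := f) ?_
        (pullback.lift_snd _ _ _) (IsPullback.of_hasPullback _ _)
      rw [pullback.lift_fst, d.fac]
      exact IsPullback.of_hasPullback _ _
    have h : pullback.lift (f := f) (g := d.p) (𝟙 Y) (𝟙 Y ≫ d.i) w = pullback.diagonal f ≫ j := by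
      apply pullback.hom_ext
      · rw [pullback.lift_fst, Category.assoc, pullback.lift_fst, pullback.diagonal_fst]
      · rw [pullback.lift_snd, Category.assoc, pullback.lift_snd, pullback.diagonal_snd_assoc,
          Category.id_comp]
    rw [h, hj.comp_iff_right]
  constructor
  · rintro ⟨w, d, hd⟩
    have := hasPullback f d.p d.hp
    exact (key d _).1 hd
  · intro h
    obtain ⟨d⟩ := MorphismProperty.HasFactorization.nonempty_mapFactorizationData
      (W₁ := (fib (C := C)).llp) (W₂ := fib (C := C)) f
    have := hasPullback f d.p d.hp
    exact ⟨rfl, d, (key d _).2 h⟩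

/-- Univalence can be tested with any choice of path objects. -/
lemma isHomotopyEquiv_delta_iff [IsPiTribe C] {E B : C} (p : E ⟶ B) (hp : fib p)
    (P P' : PathObject (baseChange (prod.fst : B ⨯ B ⟶ B) p hp))
    (Q Q' : PathObject (baseChange (prod.snd : B ⨯ B ⟶ B) p hp)) :
    IsHomotopyEquiv (delta p hp P Q).left ↔ IsHomotopyEquiv (delta p hp P' Q').left := by
  obtain ⟨w, hw, h⟩ := exists_isHomotopyEquiv_eqObj P P' Q Q'
  have hδ : delta p hp P Q ≫ w = delta p hp P' Q' := h _ _ _ _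
  rw [← over_comp_left hδ, hw.comp_iff_right]

/-- The object of equivalences of a pullback `q` of `p` along a fibration `f` is a pullback of the
object of equivalences of `p`, compatibly with `δ`. -/
lemma exists_isPullback_delta [HasDependentProducts C] {X E Y B : C} {h : X ⟶ E} {q : X ⟶ Y}
    {p : E ⟶ B} {f : Y ⟶ B} (sq : IsPullback h q p f) (hp : fib p) (hq : fib q) (hf : fib f)
    (P : PathObject (baseChange (prod.fst : B ⨯ B ⟶ B) p hp))
    (Q : PathObject (baseChange (prod.snd : B ⨯ B ⟶ B) p hp)) :
    ∃ (P' : PathObject (baseChange (prod.fst : Y ⨯ Y ⟶ Y) q hq))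
      (Q' : PathObject (baseChange (prod.snd : Y ⨯ Y ⟶ Y) q hq))
      (g : (eqObj P' Q').obj.left ⟶ (eqObj P Q).obj.left),
      IsPullback g (eqObj P' Q').obj.hom (eqObj P Q).obj.hom (prod.map f f) ∧
        (delta q hq P' Q').left ≫ g = f ≫ (delta p hp P Q).left := by
  have hr := fib_prod_map hf hf
  -- Both projections commute with `f × f`, so the two pullbacks of `q` to `Y ⨯ Y` are base changes
  -- along `f × f` of the corresponding pullbacks of `p` to `B ⨯ B`.
  obtain ⟨α, hα, hα'⟩ := exists_isCart_baseChange hp hq sq (prod.map_fst f f)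
  obtain ⟨β, hβ, hβ'⟩ := exists_isCart_baseChange hp hq sq (prod.map_snd f f)
  obtain ⟨P', π, hP⟩ := exists_isBaseChange hr hα P
  obtain ⟨Q', θ, hQ⟩ := exists_isBaseChange hr hβ Q
  obtain ⟨γ, hγ, hγ'⟩ := exists_isCart_eqObj hα hβ hP hQ
  let u : (Over.map (prod.map f f)).obj (Over.mk (diag Y)) ⟶ Over.mk (diag B) :=
    Over.homMk f (by simp [prod.lift_map, prod.comp_lift])
  have hd (Z : C) : (Over.mk (diag Z)).hom ≫ prod.fst = (Over.mk (diag Z)).hom ≫ prod.snd :=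
    (prod.lift_fst _ _).trans (prod.lift_snd _ _).symm
  refine ⟨P', Q', γ.left, hγ, ?_⟩
  -- Morphisms into an object of equivalences are equal once their data are. The three morphism
  -- components are transports along identities, and the two homotopies are constant because the
  -- pulled-back path objects are compatible with `refl`.
  have key : (Over.map (prod.map f f)).map (delta q hq P' Q') ≫ γ = u ≫ delta p hp P Q := by
    apply eqDatum_injective
    rw [hγ', eqDatum_comp, delta, delta, eqDatum_eqLift, eqDatum_eqLift]
    ext1
    · exact transpose_idTransport hp hq hα hα' hβ' u (hd Y) (hd B)
    · exact transpose_idTransport hp hq hβ hβ' hα' u (hd Y).symm (hd B).symm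
    · exact transpose_idTransport hp hq hβ hβ' hα' u (hd Y).symm (hd B).symm
    · simp only [EqDatum.baseChange, EqDatum.restrict, EqDatum.ofIso]
      rw [transpose_comp hβ hQ.refl, transpose_tsnd, ← Category.assoc, tmap_tsnd]
    · simp only [EqDatum.baseChange, EqDatum.restrict, EqDatum.ofIso]
      rw [transpose_comp hα hP.refl, transpose_tsnd, ← Category.assoc, tmap_tsnd]
  exact congrArg (fun k ↦ k.left) key

/-- A pair of points of `Y` whose images in `B` form a diagonal pair is a point of `Y ×_B Y`. -/
lemma isPullback_diag {Y B : C} (f : Y ⟶ B) [HasPullback f f] :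
    IsPullback (pullback.fst f f ≫ f) (prod.lift (pullback.fst f f) (pullback.snd f f)) (diag B)
      (prod.map f f) := by
  refine ⟨⟨?_⟩, ⟨PullbackCone.IsLimit.mk _
    (fun s ↦ pullback.lift (s.snd ≫ prod.fst) (s.snd ≫ prod.snd) ?_) (fun s ↦ ?_) (fun s ↦ ?_)
    (fun s m h1 h2 ↦ ?_)⟩⟩
  · rw [prod.lift_map, prod.comp_lift, Category.comp_id, ← pullback.condition]
  · have h1 := congrArg (· ≫ prod.fst) s.condition
    have h2 := congrArg (· ≫ prod.snd) s.condition
    simp only [Category.assoc, prod.lift_fst, prod.lift_snd, prod.map_fst, prod.map_snd] at h1 h2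
    rw [Category.assoc, Category.assoc, ← h1, ← h2]
  · have h1 := congrArg (· ≫ prod.fst) s.condition
    simp only [Category.assoc, prod.lift_fst, prod.map_fst] at h1
    rw [pullback.lift_fst_assoc, Category.assoc, ← h1, Category.comp_id]
  · apply Limits.prod.hom_ext
    · simp only [Category.assoc, prod.lift_fst, pullback.lift_fst]
    · simp only [Category.assoc, prod.lift_snd, pullback.lift_snd]
  · apply pullback.hom_ext
    · rw [pullback.lift_fst, ← h2, Category.assoc, prod.lift_fst]
    · rw [pullback.lift_snd, ← h2, Category.assoc, prod.lift_snd]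

/-- Pulled back univalence amounts to the diagonal of `f` being a homotopy equivalence. -/
lemma isHomotopyEquiv_iff_diagonal {Y B D D' : C} {f : Y ⟶ B} (hf : fib f) [HasPullback f f]
    {ε : D ⟶ B ⨯ B} {ε' : D' ⟶ Y ⨯ Y} {g : D' ⟶ D} (sq : IsPullback g ε' ε (prod.map f f))
    {δ : B ⟶ D} {δ' : Y ⟶ D'} (hδ : δ ≫ ε = diag B) (hδ' : δ' ≫ ε' = diag Y)
    (w : δ' ≫ g = f ≫ δ) (h : IsHomotopyEquiv δ) :
    IsHomotopyEquiv δ' ↔ IsHomotopyEquiv (pullback.diagonal f) := by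
  have sqd := isPullback_diag f
  rw [← hδ] at sqd
  -- Cancelling the square `sq` from the pullback of the diagonal exhibits `κ` as the base change of
  -- `δ` along `g`, which is a fibration as a base change of `f × f`.
  let κ := sq.lift ((pullback.fst f f ≫ f) ≫ δ) (prod.lift (pullback.fst f f) (pullback.snd f f))
    (by rw [Category.assoc, sqd.w])
  have hκ1 : κ ≫ g = (pullback.fst f f ≫ f) ≫ δ := sq.lift_fst _ _ _
  have hκ2 : κ ≫ ε' = prod.lift (pullback.fst f f) (pullback.snd f f) := sq.lift_snd _ _ _
  have hκ : IsHomotopyEquiv κ :=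
    IsHomotopyEquiv.of_isPullback (IsPullback.of_bot (by rwa [hκ2]) hκ1.symm sq)
      (MorphismProperty.of_isPullback sq.flip (fib_prod_map hf hf)) h
  have hd : pullback.diagonal f ≫ κ = δ' := by
    apply sq.hom_ext
    · rw [Category.assoc, hκ1, w, Category.assoc, pullback.diagonal_fst_assoc]
    · rw [Category.assoc, hκ2, hδ', prod.comp_lift, pullback.diagonal_fst, pullback.diagonal_snd]
  rw [← hd, hκ.comp_iff_right]

end Univalence

end Tribe

theorem mainTheorem9 {C : Type u} [Category.{v} C] [Tribe C] [Tribe.IsPiTribe C]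
    {X E Y B : C} (h : X ⟶ E) (q : X ⟶ Y) (p : E ⟶ B) (f : Y ⟶ B)
    (hp : Tribe.fib p) (hf : Tribe.fib f) (sq : IsPullback h q p f)
    (hu : Tribe.IsUnivalent p) :
    Tribe.IsUnivalent q ↔ Tribe.IsHomotopyMono f := by
  obtain ⟨_, P, Q, hδ⟩ := hu
  have hq : Tribe.fib q := MorphismProperty.of_isPullback sq hp
  have := Tribe.hasPullback f f hf
  obtain ⟨P', Q', g, sqg, w⟩ := Tribe.exists_isPullback_delta sq hp hq hf P Q
  rw [Tribe.isHomotopyMono_iff hf, ← Tribe.isHomotopyEquiv_iff_diagonal hf sqg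
    (Over.w (Tribe.delta p hp P Q)) (Over.w (Tribe.delta q hq P' Q')) w hδ]
  -- Univalence of `q` only provides some path objects, so the forward direction first passes to the
  -- pulled-back `P'` and `Q'`; conversely these serve directly as witnesses.
  constructor
  · rintro ⟨_, P'', Q'', hδ'⟩
    exact (Tribe.isHomotopyEquiv_delta_iff q hq P'' P' Q'' Q').1 hδ'
  · intro hδ'
    exact ⟨hq, P', Q', hδ'⟩
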